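/- Let $g,n\ge 0$ and let $(p_j,q_j)$, $1\le j\le n$, be pairs of coprime integers with $p_j\ne 0$. Let $X=X_{g,\{p/q\}}$ be the Seifert manifold obtained from $\Sigma_g\times S^1$ by rational $(p_j,q_j)$ surgeries on $n$ fibers. Its fundamental group $\pi_1(X)$ has generators $a_1,\dots,a_n,b,c_1,d_1,\dots,c_g,d_g$ and relations: $b$ is central, $a_j^{p_j}b^{q_j}=1$ for all $j$, and $a_1\cdots a_n=\prod_{i=1}^g c_id_ic_i^{-1}d_i^{-1}$. Put $H=\prod_j p_j\cdot\sum_j q_j/p_j$. Let $\mathcal M=\mathrm{Hom}(\pi_1(X),SU(2))/SU(2)$ (conjugation) be the moduli space of flat $SU(2)$ connections, with the quotient of the topology of pointwise convergence. A flat connection is irreducible if only the center of $SU(2)$ commutes with all its holonomies, and reducible otherwise. For a flat connection and $x\in\pi_1(X)$ let $\phi(x)\in[0,\frac12]$ be the number such that the holonomy of $x$ is conjugate in $SU(2)$ to $\mathrm{diag}(e^{2\pi i\phi(x)},e^{-2\pi i\phi(x)})$. For $\tilde m\in\mathbb Z^n$ and $\tilde l\in\{0,1\}$ put $\theta_j=(\tilde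 m_j+q_j\tilde l/2)/p_j$, and let $\mathcal M_{\tilde m;\tilde l}\subset\mathcal M$ be the set of classes of flat connections with $\phi(b)=\tilde l/2$ (that is, the holonomy of $b$ is $(-1)^{\tilde l}$) and $\phi(a_j)=\theta_j$ for all $j$. Let $I$ be the set of all $(\tilde m,\tilde l)$ such that * $0\le\theta_j\le\frac12$ for all $j$; * if $g=0$: $n\ge1$ and the strict quantum polygon inequalities hold, i.e. $\sum_{j\in S}\theta_j-\sum_{j\notin S}\theta_j<\frac{|S|-1}{2}$ for every $S\subseteq\{1,\dots,n\}$ with $|S|$ odd; * if $g=1$: it is not the case that all $\theta_j\in\{0,\frac12\}$ and $\sum_j\theta_j\in\mathbb Z$. Then: 1. $(\tilde m,\tilde l)\mapsto\mathcal M_{\tilde m;\tilde l}$ is a bijection from $I$ onto the set of those connected components of the subspace $\{\phi(b)\in\{0,\frac12\}\}$ of $\mathcal M$ that contain an irreducible connection (all irreducible connections lie in this subspace). 2. If $H\neq0$, it is also a bijection from $I$ onto the set of those connected components of the whole moduli space $\mathcal M$ that contain an irreducible connection. 3. If $(\tilde m,\tilde l)\in I$ and there are signs $\tilde\mu_j=\pm1$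 with $\sum_{j=1}^n\tilde\mu_j\theta_j\in\mathbb Z$, then $\mathcal M_{\tilde m;\tilde l}$ also contains reducible connections (a special component). -/

import Mathlib

noncomputable section

namespace SeifertFlat

/-- The gauge group `SU(2)`, with the topology of complex `2 × 2` matrices. -/
abbrev SU2 : Type := Matrix.specialUnitaryGroup (Fin 2) ℂ

/-- The element `exp (2 π i θ σ₃) = diag (e^{2 π i θ}, e^{-2 π i θ})` of `SU(2)`. -/
def torusElement (θ : ℝ) : SU2 :=
  ⟨Matrix.diagonal ![Complex.exp (2 * Real.pi * θ * Complex.I),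
      Complex.exp (-(2 * Real.pi * θ * Complex.I))], by
    have h (x : ℝ) : (starRingEnd ℂ) (Complex.exp (2 * Real.pi * x * Complex.I)) =
        Complex.exp (-(2 * Real.pi * x * Complex.I)) := by
      rw [← Complex.exp_conj]
      simp [Complex.conj_ofNat]
    have h' : (starRingEnd ℂ) (Complex.exp (-(2 * Real.pi * θ * Complex.I))) =
        Complex.exp (2 * Real.pi * θ * Complex.I) := by
      rw [← h, Complex.conj_conj]
    rw [Matrix.mem_specialUnitaryGroup_iff, Matrix.mem_unitaryGroup_iff]
    constructor
    · rw [Matrix.star_eq_conjTranspose, Matrix.diagonal_conjTranspose, Matrix.diagonal_mul_diagonal,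
        ← Matrix.diagonal_one]
      congr 1
      funext i
      fin_cases i
      · simp [h, ← Complex.exp_add]
      · simp [h', ← Complex.exp_add]
    · simp [Matrix.det_diagonal, ← Complex.exp_add]⟩

/-- `HasPhase U θ` says `φ(U) = θ`: the number `θ` lies in `[0, 1/2]`, and `U` and
`exp (2 π i θ σ₃)` belong to the same conjugacy class of `SU(2)`. -/
def HasPhase (U : SU2) (θ : ℝ) : Prop :=
  θ ∈ Set.Icc (0 : ℝ) (1 / 2) ∧ IsConj U (torusElement θ)

/-- The generators of the fundamental group of the Seifert manifold: the loops `a j` around the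
punctures, the fibre `b`, and the standard generators `c i`, `d i` of the surface. -/
inductive Gen (g n : ℕ) : Type
  | a (j : Fin n) : Gen g n
  | b : Gen g n
  | c (i : Fin g) : Gen g n
  | d (i : Fin g) : Gen g n

/-- The group commutator. -/
def comm {G : Type} [Group G] (x y : G) : G := x * y * x⁻¹ * y⁻¹

/-- The relators: `a_j ^ p_j * b ^ q_j`, the commutators of `b` with all generators, and
`a_1 ⋯ a_n = [c_1, d_1] ⋯ [c_g, d_g]`. -/
def relators (g : ℕ) {n : ℕ} (p q : Fin n → ℤ) : Set (FreeGroup (Gen g n)) :=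
  {r | (∃ j : Fin n, r = FreeGroup.of (Gen.a j) ^ p j * FreeGroup.of Gen.b ^ q j) ∨
    (∃ y : Gen g n, r = comm (FreeGroup.of Gen.b) (FreeGroup.of y)) ∨
    r = (List.ofFn fun j : Fin n => FreeGroup.of (Gen.a j : Gen g n)).prod *
      ((List.ofFn fun i : Fin g =>
        comm (FreeGroup.of (Gen.c i : Gen g n)) (FreeGroup.of (Gen.d i))).prod)⁻¹}

/-- The fundamental group of the Seifert manifold obtained from `Σ_g × S¹` by rational
`(p_j, q_j)` surgeries on `n` fibres. -/
abbrev SeifertGroup (g : ℕ) {n : ℕ} (p q : Fin n → ℤ) : Type :=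
  PresentedGroup (relators g p q)

variable {g n : ℕ} {p q : Fin n → ℤ}

/-- A generator, as an element of the fundamental group. -/
def gen (g : ℕ) {n : ℕ} (p q : Fin n → ℤ) (x : Gen g n) : SeifertGroup g p q :=
  PresentedGroup.of x

/-- Holonomy homomorphisms from the fundamental group to `SU(2)`. -/
def Hol (g : ℕ) {n : ℕ} (p q : Fin n → ℤ) : Type := SeifertGroup g p q →* SU2

instance : FunLike (Hol g p q) (SeifertGroup g p q) SU2 :=
  inferInstanceAs (FunLike (SeifertGroup g p q →* SU2) (SeifertGroup g p q) SU2)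

/-- The topology of pointwise convergence, i.e. the subspace topology from `SU(2) ^ π₁`. -/
instance : TopologicalSpace (Hol g p q) :=
  TopologicalSpace.induced (fun ρ (x : SeifertGroup g p q) => ρ x) inferInstance

/-- Gauge equivalence of flat connections: the holonomies are conjugate by one element. -/
instance gaugeSetoid (g : ℕ) {n : ℕ} (p q : Fin n → ℤ) : Setoid (Hol g p q) where
  r ρ ρ' := ∃ h : SU2, ∀ x, ρ' x = h⁻¹ * ρ x * h
  iseqv :=
    { refl := fun ρ => ⟨1, fun x => by simp⟩
      symm := fun ⟨h, hh⟩ => ⟨h⁻¹, fun x => by rw [hh x]; group⟩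
      trans := fun ⟨h, hh⟩ ⟨k, hk⟩ => ⟨h * k, fun x => by rw [hk x, hh x]; group⟩ }

/-- The moduli space of flat `SU(2)` connections, `Hom(π₁, SU(2))` modulo conjugation, with the
quotient topology. -/
abbrev Moduli (g : ℕ) {n : ℕ} (p q : Fin n → ℤ) : Type := Quotient (gaugeSetoid g p q)

/-- A flat connection is irreducible if its isotropy group (the elements of `SU(2)` commuting with
all holonomies) is the centre of `SU(2)`. -/
def IsIrreducible (ρ : Hol g p q) : Prop :=
  ∀ h : SU2, (∀ x, h * ρ x = ρ x * h) → h ∈ Subgroup.center SU2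

/-- The gauge classes of irreducible flat connections. -/
def irreducibleLocus (g : ℕ) {n : ℕ} (p q : Fin n → ℤ) : Set (Moduli g p q) :=
  {x | ∃ ρ : Hol g p q, IsIrreducible ρ ∧ ⟦ρ⟧ = x}

/-- The gauge classes of reducible flat connections. -/
def reducibleLocus (g : ℕ) {n : ℕ} (p q : Fin n → ℤ) : Set (Moduli g p q) :=
  {x | ∃ ρ : Hol g p q, ¬ IsIrreducible ρ ∧ ⟦ρ⟧ = x}

/-- The gauge classes of flat connections with `φ(b) = 0` or `φ(b) = 1/2`. -/
def centralLocus (g : ℕ) {n : ℕ} (p q : Fin n → ℤ) : Set (Moduli g p q) :=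
  {x | ∃ ρ : Hol g p q, (HasPhase (ρ (gen g p q .b)) 0 ∨ HasPhase (ρ (gen g p q .b)) (1 / 2)) ∧
    ⟦ρ⟧ = x}

/-- The number `(m_j + q_j l / 2) / p_j` attached to an index `(m, l)`, `l ∈ {0, 1}`. -/
def phase {n : ℕ} (p q : Fin n → ℤ) (i : (Fin n → ℤ) × Fin 2) (j : Fin n) : ℝ :=
  ((i.1 j : ℝ) + (q j : ℝ) * ((i.2.val : ℝ) / 2)) / (p j : ℝ)

/-- The set `M_{m; l}` of gauge classes of flat connections with `φ(b) = l / 2` and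
`φ(a_j) = (m_j + q_j l / 2) / p_j` for all `j`. -/
def stratum (g : ℕ) {n : ℕ} (p q : Fin n → ℤ) (i : (Fin n → ℤ) × Fin 2) : Set (Moduli g p q) :=
  {x | ∃ ρ : Hol g p q, HasPhase (ρ (gen g p q .b)) ((i.2.val : ℝ) / 2) ∧
    (∀ j, HasPhase (ρ (gen g p q (.a j))) (phase p q i j)) ∧ ⟦ρ⟧ = x}

/-- The strict quantum polygon inequalities for phases in `[0, 1/2]`. -/
def QuantumPolygon {n : ℕ} (θ : Fin n → ℝ) : Prop :=
  0 < n ∧ ∀ S : Finset (Fin n), Odd S.card →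
    ∑ j ∈ S, θ j - ∑ j ∈ Sᶜ, θ j < ((S.card : ℝ) - 1) / 2

/-- The indices of the components: the phases lie in `[0, 1/2]`; they satisfy the strict quantum
polygon inequalities if `g = 0`; and if `g = 1`, then it is not the case that all phases are
`0` or `1/2` and add up to an integer. -/
def indexSet (g : ℕ) {n : ℕ} (p q : Fin n → ℤ) : Set ((Fin n → ℤ) × Fin 2) :=
  {i | (∀ j, 0 ≤ phase p q i j ∧ phase p q i j ≤ 1 / 2) ∧
    (g = 0 → QuantumPolygon (phase p q i)) ∧
    (g = 1 → ¬ ((∀ j, phase p q i j = 0 ∨ phase p q i j = 1 / 2) ∧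
      ∃ k : ℤ, ∑ j, phase p q i j = k))}

/-- `H = P ∑ q_j / p_j` with `P = ∏ p_j`. -/
def eulerH {n : ℕ} (p q : Fin n → ℤ) : ℚ :=
  (∏ j, (p j : ℚ)) * ∑ j, (q j : ℚ) / (p j : ℚ)

end SeifertFlat

end

noncomputable section

namespace SeifertFlat

section ComplexCoordinates

open Complex ComplexConjugate

/-! ### Coordinates on `SU(2)` -/

/-! Where `b` acts as `±1`, the relation `a_j ^ p_j * b ^ q_j = 1` confines `φ(a_j)` to a discrete
set of rationals. The phases of `b` and `a_j` are continuous on the moduli space, so they are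
constant on connected subsets of the central locus. That locus is thus the disjoint union of the
strata, and a component lies in each stratum that it meets (`component_subset_stratum`). Two
questions remain: is each stratum connected, and which strata contain an irreducible connection?

Both are settled by the geometry of triangles of phases. Given `U`, the phases of `a` and `U * a`
can be prescribed exactly within the triangle inequalities (`tri_mul`, `exists_of_tri`), the
triangle is degenerate exactly when `U` and `a` commute (`strictTri_mul_iff`), and the solutions `a`
form a connected set (`isPreconnected_circle`).

For connectedness, the defining product relation is built up one factor or commutator at a time. The
invariant `ConnectedLevels` (convex image of the phase, connected level sets) is an elementary
analogue of the convexity and connectedness theorems for moment maps. It survives each step because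
a compact set with connected fibres over a connected image is connected
(`isPreconnected_of_fibers`).

For irreducibility, centralisers of non-central elements are abelian, so irreducible means that some
generators fail to commute; `b` is then central. The product of elements with phases `θ` takes
exactly the phases in `[0, 1/2]` between `1/2 - oddDist θ` and `evenDist θ`, and non-commuting
tuples take exactly those strictly between. In genus 0 the product is `1`, which gives `1/2 <
oddDist θ`, the quantum polygon condition. In genus 1 the only obstruction is that the `a_j` are
central with product `1`. In genus at least 2 there is none, as every element is a commutator.

If `H ≠ 0`, a non-central `b` makes the whole representation abelian and the relations give it
finite order. So `φ(b)` is rational everywhere, hence constant on components of the whole moduli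
space. Special components contain representations into the diagonal torus. -/

lemma star_eq_adjugate (U : SU2) : star U.1 = Matrix.adjugate U.1 := by
  have h := Matrix.mem_specialUnitaryGroup_iff.1 U.2
  have h1 : star U.1 * U.1 = 1 := Matrix.mem_unitaryGroup_iff'.1 h.1
  have h2 : U.1 * Matrix.adjugate U.1 = 1 := by rw [Matrix.mul_adjugate, h.2, one_smul]
  exact left_inv_eq_right_inv h1 h2

lemma apply_one_one (U : SU2) : U.1 1 1 = conj (U.1 0 0) := by
  have := congrFun (congrFun (star_eq_adjugate U) 0) 0
  rw [Matrix.adjugate_fin_two] at this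
  simpa [Matrix.star_apply] using this.symm

lemma apply_zero_one (U : SU2) : U.1 0 1 = -conj (U.1 1 0) := by
  have := congrFun (congrFun (star_eq_adjugate U) 0) 1
  rw [Matrix.adjugate_fin_two] at this
  simp [Matrix.star_apply] at this
  rw [this, neg_neg]

lemma normSq_add_normSq (U : SU2) : normSq (U.1 0 0) + normSq (U.1 1 0) = 1 := by
  have h := (Matrix.mem_specialUnitaryGroup_iff.1 U.2).2
  rw [Matrix.det_fin_two, apply_one_one, apply_zero_one, mul_conj, neg_mul,
    mul_comm (conj _), mul_conj, sub_neg_eq_add] at h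
  exact_mod_cast h

lemma su2_ext {U V : SU2} (h0 : U.1 0 0 = V.1 0 0) (h1 : U.1 1 0 = V.1 1 0) : U = V := by
  apply Subtype.ext
  ext i j
  fin_cases i <;> fin_cases j
  · exact h0
  · simp only [Fin.mk_one, Fin.zero_eta]; rw [apply_zero_one, apply_zero_one, h1]
  · exact h1
  · simp only [Fin.mk_one]; rw [apply_one_one, apply_one_one, h0]

/-- The element of `SU(2)` with first column `(z, w)`. -/
def ofPair (z w : ℂ) (h : normSq z + normSq w = 1) : SU2 :=
  ⟨!![z, -conj w; w, conj z], by
    have h' : z * conj z + w * conj w = 1 := by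
      rw [mul_conj, mul_conj]; exact_mod_cast h
    rw [Matrix.mem_specialUnitaryGroup_iff, Matrix.mem_unitaryGroup_iff]
    constructor
    · ext i j
      fin_cases i <;> fin_cases j <;>
        simp [Matrix.mul_apply, Fin.sum_univ_two, Matrix.star_apply] <;>
        first | linear_combination h' | ring
    · rw [Matrix.det_fin_two_of]; linear_combination h'⟩

@[simp] lemma ofPair_zero_zero (z w : ℂ) (h) : (ofPair z w h).1 0 0 = z := rfl
@[simp] lemma ofPair_one_zero (z w : ℂ) (h) : (ofPair z w h).1 1 0 = w := rfl

lemma mul_zero_zero (U V : SU2) :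
    (U * V).1 0 0 = U.1 0 0 * V.1 0 0 - conj (U.1 1 0) * V.1 1 0 := by
  rw [Submonoid.coe_mul, Matrix.mul_apply, Fin.sum_univ_two, apply_zero_one U]; ring

lemma mul_one_zero (U V : SU2) :
    (U * V).1 1 0 = U.1 1 0 * V.1 0 0 + conj (U.1 0 0) * V.1 1 0 := by
  rw [Submonoid.coe_mul, Matrix.mul_apply, Fin.sum_univ_two, apply_one_one U]

lemma inv_zero_zero (U : SU2) : (U⁻¹).1 0 0 = conj (U.1 0 0) := rfl

@[simp] lemma su2_one_zero_zero : (1 : SU2).1 0 0 = 1 := rfl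
@[simp] lemma su2_one_one_zero : (1 : SU2).1 1 0 = 0 := rfl

lemma torusElement_zero_zero (θ : ℝ) :
    (torusElement θ).1 0 0 = Complex.exp (2 * Real.pi * θ * Complex.I) := rfl
@[simp] lemma torusElement_one_zero (θ : ℝ) : (torusElement θ).1 1 0 = 0 := rfl

lemma torusElement_zero_zero_eq (θ : ℝ) : (torusElement θ).1 0 0 =
    Real.cos (2 * Real.pi * θ) + Real.sin (2 * Real.pi * θ) * Complex.I := by
  rw [torusElement_zero_zero, Complex.exp_mul_I]; push_cast; rfl

lemma torusElement_add (s t : ℝ) : torusElement (s + t) = torusElement s * torusElement t := by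
  apply su2_ext
  · rw [mul_zero_zero, torusElement_zero_zero, torusElement_zero_zero, torusElement_zero_zero,
      torusElement_one_zero, map_zero, zero_mul, sub_zero, ← Complex.exp_add]
    push_cast; ring_nf
  · rw [mul_one_zero]; simp

@[simp] lemma torusElement_zero : torusElement 0 = 1 := by
  apply su2_ext
  · rw [torusElement_zero_zero]; simp
  · simp

lemma torusElement_eq_one_iff (θ : ℝ) : torusElement θ = 1 ↔ ∃ k : ℤ, θ = k := by
  constructor
  · intro h
    have := congrArg (fun U : SU2 => U.1 0 0) h
    simp only [torusElement_zero_zero, su2_one_zero_zero] at this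
    obtain ⟨k, hk⟩ := Complex.exp_eq_one_iff.1 this
    refine ⟨k, ?_⟩
    have hpi : (2 * Real.pi * Complex.I : ℂ) ≠ 0 := Complex.two_pi_I_ne_zero
    have : (θ : ℂ) = k := mul_right_cancel₀ hpi (by rw [← hk]; ring)
    exact_mod_cast this
  · rintro ⟨k, rfl⟩
    apply su2_ext
    · rw [torusElement_zero_zero, su2_one_zero_zero, Complex.exp_eq_one_iff]
      exact ⟨k, by push_cast; ring⟩
    · simp

/-- `torusElement` as a homomorphism. -/
def torusHom : Multiplicative ℝ →* SU2 where
  toFun t := torusElement t.toAdd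
  map_one' := torusElement_zero
  map_mul' _ _ := torusElement_add _ _

lemma torusElement_zpow (θ : ℝ) (k : ℤ) : torusElement θ ^ k = torusElement (k * θ) := by
  have := map_zpow torusHom (Multiplicative.ofAdd θ) k
  rw [← ofAdd_zsmul, zsmul_eq_mul] at this
  exact this.symm

lemma torusElement_inv (θ : ℝ) : (torusElement θ)⁻¹ = torusElement (-θ) := by
  have := torusElement_zpow θ (-1)
  simpa using this

lemma torusElement_commute (s t : ℝ) : torusElement s * torusElement t =
    torusElement t * torusElement s := by
  rw [← torusElement_add, ← torusElement_add, add_comm]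

lemma prod_ofFn_torusElement {n : ℕ} (t : Fin n → ℝ) :
    (List.ofFn fun j => torusElement (t j)).prod = torusElement (∑ j, t j) := by
  induction n with
  | zero => simp
  | succ n ih =>
    rw [List.ofFn_succ, List.prod_cons, ih, Fin.sum_univ_succ, torusElement_add]

/-! ### Topology of `SU(2)` -/

instance : ContinuousInv SU2 :=
  ⟨Continuous.subtype_mk (continuous_star.comp continuous_subtype_val) _⟩

instance : IsTopologicalGroup SU2 := {}

lemma continuous_zero_zero : Continuous fun U : SU2 => U.1 0 0 :=
  (continuous_apply_apply 0 0).comp continuous_subtype_val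

lemma continuous_ofPair {X : Type*} [TopologicalSpace X] {z w : X → ℂ}
    (hz : Continuous z) (hw : Continuous w) (h : ∀ x, normSq (z x) + normSq (w x) = 1) :
    Continuous fun x => ofPair (z x) (w x) (h x) := by
  refine Continuous.subtype_mk ?_ _
  refine continuous_matrix fun i j => ?_
  fin_cases i <;> fin_cases j <;> simp <;> fun_prop

lemma ofPair_surjective (U : SU2) : ∃ z w h, ofPair z w h = U :=
  ⟨U.1 0 0, U.1 1 0, normSq_add_normSq U, su2_ext rfl rfl⟩

instance : CompactSpace SU2 := by
  let S : Set (ℂ × ℂ) := {v | normSq v.1 + normSq v.2 = 1}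
  have hc : IsCompact S := by
    apply Metric.isCompact_of_isClosed_isBounded
    · exact isClosed_eq (by fun_prop) (by fun_prop)
    · refine (Metric.isBounded_closedBall (x := (0 : ℂ × ℂ)) (r := 1)).subset fun v hv => ?_
      have hv : normSq v.1 + normSq v.2 = 1 := hv
      rw [normSq_eq_norm_sq, normSq_eq_norm_sq] at hv
      rw [mem_closedBall_zero_iff, Prod.norm_def, max_le_iff]
      constructor <;> nlinarith [norm_nonneg v.1, norm_nonneg v.2]
  have : CompactSpace S := isCompact_iff_compactSpace.1 hc
  have hf : Continuous fun v : S => ofPair v.1.1 v.1.2 v.2 :=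
    continuous_ofPair (by fun_prop) (by fun_prop) _
  have hs : Function.Surjective fun v : S => ofPair v.1.1 v.1.2 v.2 := fun U => by
    obtain ⟨z, w, h, rfl⟩ := ofPair_surjective U
    exact ⟨⟨(z, w), h⟩, rfl⟩
  exact hs.compactSpace hf

lemma exists_polar (z : ℂ) {r : ℝ} (h : normSq z = r ^ 2) (hr : 0 ≤ r) :
    ∃ s : ℝ, z = r * Complex.exp (s * Complex.I) := by
  refine ⟨z.arg, ?_⟩
  have : ‖z‖ = r := by
    rw [normSq_eq_norm_sq] at h
    exact (pow_left_inj₀ (norm_nonneg z) hr two_ne_zero).1 h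
  rw [← this, Complex.norm_mul_exp_arg_mul_I]

lemma normSq_mul_exp (r s : ℝ) : normSq (r * Complex.exp (s * Complex.I)) = r ^ 2 := by
  rw [normSq_eq_norm_sq, norm_mul, Complex.norm_exp_ofReal_mul_I, mul_one, Complex.norm_real,
    Real.norm_eq_abs, sq_abs]

/-- Hopf coordinates on the 3-sphere: one angle splits the norm between the two entries of the first
column, the other two are their arguments. -/
instance : ConnectedSpace SU2 := by
  have hn (v : ℝ × ℝ × ℝ) : normSq (Real.cos v.1 * Complex.exp (v.2.1 * Complex.I)) +
      normSq (Real.sin v.1 * Complex.exp (v.2.2 * Complex.I)) = 1 := by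
    rw [normSq_mul_exp, normSq_mul_exp, Real.cos_sq_add_sin_sq]
  have hf : Continuous fun v : ℝ × ℝ × ℝ => ofPair _ _ (hn v) :=
    continuous_ofPair (by fun_prop) (by fun_prop) _
  have hs : Function.Surjective fun v : ℝ × ℝ × ℝ => ofPair _ _ (hn v) := fun U => by
    obtain ⟨z, w, h, rfl⟩ := ofPair_surjective U
    have h1 := normSq_nonneg z
    have h2 := normSq_nonneg w
    obtain ⟨x, hx0, hx1, hx⟩ : ∃ x : ℝ, 0 ≤ x ∧ x ≤ Real.pi / 2 ∧ Real.cos x = √(normSq z) := by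
      refine ⟨Real.arccos √(normSq z), Real.arccos_nonneg _, ?_, Real.cos_arccos ?_ ?_⟩
      · exact Real.arccos_le_pi_div_two.2 (Real.sqrt_nonneg _)
      · linarith [Real.sqrt_nonneg (normSq z)]
      · exact Real.sqrt_le_one.2 (by linarith)
    have hc : Real.cos x ^ 2 = normSq z := by rw [hx, Real.sq_sqrt h1]
    have hsn : 0 ≤ Real.sin x :=
      Real.sin_nonneg_of_nonneg_of_le_pi hx0 (by linarith [Real.pi_pos])
    obtain ⟨s, hs⟩ := exists_polar z hc.symm (hx ▸ Real.sqrt_nonneg _)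
    obtain ⟨t, ht⟩ := exists_polar w (r := Real.sin x)
      (by linarith [Real.cos_sq_add_sin_sq x]) hsn
    exact ⟨(x, s, t), su2_ext hs.symm ht.symm⟩
  exact hs.connectedSpace hf

/-! ### The phase of an element of `SU(2)` -/

/-- The phase `φ(U) ∈ [0, 1/2]`, as a function of the trace. -/
def phi (U : SU2) : ℝ := Real.arccos (U.1 0 0).re / (2 * Real.pi)

lemma continuous_phi : Continuous phi :=
  (Real.continuous_arccos.comp (Complex.continuous_re.comp continuous_zero_zero)).div_const _

lemma phi_nonneg (U : SU2) : 0 ≤ phi U :=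
  div_nonneg (Real.arccos_nonneg _) (by positivity)

lemma phi_le_half (U : SU2) : phi U ≤ 1 / 2 := by
  unfold phi
  rw [div_le_iff₀ (by positivity)]
  linarith [Real.arccos_le_pi (U.1 0 0).re]

lemma re_sq_le (U : SU2) : (U.1 0 0).re ^ 2 ≤ 1 := by
  have := normSq_add_normSq U
  rw [normSq_apply, normSq_apply] at this
  nlinarith [sq_nonneg (U.1 0 0).im, sq_nonneg (U.1 1 0).re, sq_nonneg (U.1 1 0).im]

lemma cos_phi (U : SU2) : Real.cos (2 * Real.pi * phi U) = (U.1 0 0).re := by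
  unfold phi
  rw [mul_div_cancel₀ _ (by positivity)]
  exact Real.cos_arccos (neg_one_le_of_sq_le_one (re_sq_le U)) (le_one_of_sq_le_one (re_sq_le U))
where
  neg_one_le_of_sq_le_one {x : ℝ} (h : x ^ 2 ≤ 1) : -1 ≤ x := by nlinarith
  le_one_of_sq_le_one {x : ℝ} (h : x ^ 2 ≤ 1) : x ≤ 1 := by nlinarith

lemma phi_eq_iff (U : SU2) {θ : ℝ} (h0 : 0 ≤ θ) (h1 : θ ≤ 1 / 2) :
    phi U = θ ↔ (U.1 0 0).re = Real.cos (2 * Real.pi * θ) := by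
  have hp := Real.pi_pos
  constructor
  · rintro rfl; exact (cos_phi U).symm
  · intro h
    unfold phi
    rw [h, Real.arccos_cos (by positivity) (by nlinarith)]
    field_simp

lemma phi_eq_phi_iff (U V : SU2) : phi U = phi V ↔ (U.1 0 0).re = (V.1 0 0).re := by
  rw [phi_eq_iff U (phi_nonneg V) (phi_le_half V), cos_phi]

lemma sin_phi_nonneg (U : SU2) : 0 ≤ Real.sin (2 * Real.pi * phi U) := by
  have hp := Real.pi_pos
  exact Real.sin_nonneg_of_nonneg_of_le_pi (mul_nonneg (by positivity) (phi_nonneg U))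
    (by nlinarith [phi_le_half U])

lemma phi_torusElement {θ : ℝ} (h0 : 0 ≤ θ) (h1 : θ ≤ 1 / 2) : phi (torusElement θ) = θ := by
  rw [phi_eq_iff _ h0 h1, torusElement_zero_zero_eq]
  simp [-ofReal_cos, -ofReal_sin]

lemma phi_mul_comm (U V : SU2) : phi (U * V) = phi (V * U) := by
  rw [phi_eq_phi_iff, mul_zero_zero, mul_zero_zero]
  simp [mul_re, sub_re]
  ring

lemma phi_conj (h U : SU2) : phi (h * U * h⁻¹) = phi U := by
  rw [phi_mul_comm]; group

lemma phi_conj' (h U : SU2) : phi (h⁻¹ * U * h) = phi U := by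
  rw [phi_mul_comm]; group

lemma phi_inv (U : SU2) : phi U⁻¹ = phi U := by
  rw [phi_eq_phi_iff, inv_zero_zero, conj_re]

/-- Every element of `SU(2)` is diagonalisable in `SU(2)`. -/
lemma exists_diagonalization (U : SU2) : ∃ h : SU2, U = h * torusElement (phi U) * h⁻¹ := by
  set s := Real.sin (2 * Real.pi * phi U) with hs
  have hc := cos_phi U
  have hT := torusElement_zero_zero_eq (phi U)
  have hn := normSq_add_normSq U
  have hsc := Real.sin_sq_add_cos_sq (2 * Real.pi * phi U)
  rw [hc] at hT hsc
  rw [← hs] at hT hsc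
  set z := U.1 0 0 with hz
  set w := U.1 1 0 with hw
  rw [normSq_apply, normSq_apply] at hn
  have key : w.re ^ 2 + w.im ^ 2 = (s - z.im) * (s + z.im) := by nlinarith
  -- The vector `(conj w, i (z.im - s))` is an eigenvector of `U` for the eigenvalue `z.re + i s`,
  -- and `r2` is its squared norm. If it vanishes, `U` is already the torus element; otherwise its
  -- normalisation is the first column of the conjugator.
  set r2 := w.re ^ 2 + w.im ^ 2 + (z.im - s) ^ 2 with hr2
  by_cases hr : r2 = 0
  · have h1 : w.re = 0 := by nlinarith [sq_nonneg w.re, sq_nonneg w.im, sq_nonneg (z.im - s)]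
    have h2 : w.im = 0 := by nlinarith [sq_nonneg w.re, sq_nonneg w.im, sq_nonneg (z.im - s)]
    have h3 : z.im = s := by nlinarith [sq_nonneg w.re, sq_nonneg w.im, sq_nonneg (z.im - s)]
    refine ⟨1, ?_⟩
    rw [one_mul, inv_one, mul_one]
    apply su2_ext
    · rw [hT, ← hz]; apply Complex.ext <;> simp [h3]
    · rw [torusElement_one_zero, ← hw]; exact Complex.ext h1 h2
  · have hpos : 0 < r2 := lt_of_le_of_ne (by positivity) (Ne.symm hr)
    set r := √r2 with hrdef
    have hr0 : 0 < r := Real.sqrt_pos.2 hpos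
    have hrr : r ^ 2 = r2 := Real.sq_sqrt hpos.le
    have hnorm : normSq (conj w / r) + normSq (((z.im - s : ℝ) : ℂ) * Complex.I / r) = 1 := by
      rw [map_div₀, map_div₀, normSq_conj, map_mul, normSq_ofReal, normSq_ofReal, normSq_I,
        normSq_apply]
      field_simp
      nlinarith
    refine ⟨ofPair _ _ hnorm, ?_⟩
    rw [eq_mul_inv_iff_mul_eq]
    have hrc : (r : ℂ) ≠ 0 := by exact_mod_cast hr0.ne'
    apply su2_ext
    · rw [mul_zero_zero, mul_zero_zero, hT, ofPair_zero_zero, ofPair_one_zero,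
        torusElement_one_zero, ← hz, ← hw]
      field_simp
      apply Complex.ext <;> simp
    · rw [mul_one_zero, mul_one_zero, hT, ofPair_zero_zero, ofPair_one_zero,
        torusElement_one_zero, ← hz, ← hw]
      field_simp
      apply Complex.ext <;> simp <;> nlinarith

/-- Replaces the conjugacy condition by the trace function `phi`, which is continuous;
diagonalisability makes the two agree. -/
lemma hasPhase_iff (U : SU2) (θ : ℝ) : HasPhase U θ ↔ phi U = θ := by
  constructor
  · rintro ⟨⟨h0, h1⟩, hc⟩
    obtain ⟨h, hh⟩ := isConj_iff.1 hc
    rw [← phi_torusElement h0 h1, ← hh, phi_conj]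
  · rintro rfl
    refine ⟨⟨phi_nonneg U, phi_le_half U⟩, ?_⟩
    obtain ⟨h, hh⟩ := exists_diagonalization U
    exact (isConj_iff.2 ⟨h, hh.symm⟩).symm

lemma phi_eq_zero_iff (U : SU2) : phi U = 0 ↔ U = 1 := by
  constructor
  · intro h
    obtain ⟨k, hk⟩ := exists_diagonalization U
    rw [hk, h]; simp
  · rintro rfl
    rw [← torusElement_zero, phi_torusElement le_rfl (by norm_num)]

lemma torusElement_half_commute (U : SU2) :
    torusElement (1 / 2) * U = U * torusElement (1 / 2) := by
  have h : (torusElement (1 / 2)).1 0 0 = -1 := by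
    rw [torusElement_zero_zero_eq]
    rw [show 2 * Real.pi * (1 / 2) = Real.pi by ring]
    simp
  apply su2_ext
  · rw [mul_zero_zero, mul_zero_zero, h]; simp
  · rw [mul_one_zero, mul_one_zero, h]; simp

lemma phi_eq_half_iff (U : SU2) : phi U = 1 / 2 ↔ U = torusElement (1 / 2) := by
  constructor
  · intro h
    obtain ⟨k, hk⟩ := exists_diagonalization U
    rw [hk, h, ← torusElement_half_commute]; simp
  · rintro rfl
    exact phi_torusElement (by norm_num) le_rfl

/-- Elements of phase `0` or `1/2` are central. -/
lemma commute_of_phi {U : SU2} (h : phi U = 0 ∨ phi U = 1 / 2) (V : SU2) : U * V = V * U := by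
  rcases h with h | h
  · rw [(phi_eq_zero_iff U).1 h]; simp
  · rw [(phi_eq_half_iff U).1 h, torusElement_half_commute]

lemma sin_pos_of_phi {θ : ℝ} (h0 : 0 < θ) (h1 : θ < 1 / 2) : 0 < Real.sin (2 * Real.pi * θ) := by
  have := Real.pi_pos
  exact Real.sin_pos_of_pos_of_lt_pi (by positivity) (by nlinarith)

lemma torusElement_mul_comm_iff {θ : ℝ} (h0 : 0 < θ) (h1 : θ < 1 / 2) (U : SU2) :
    torusElement θ * U = U * torusElement θ ↔ U.1 1 0 = 0 := by
  constructor
  · intro h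
    have := congrArg (fun U : SU2 => U.1 1 0) h
    simp only [mul_one_zero, torusElement_one_zero, torusElement_zero_zero_eq] at this
    simp [-ofReal_cos, -ofReal_sin] at this
    have h2 : (U.1 1 0) * (2 * Real.sin (2 * Real.pi * θ) * Complex.I) = 0 := by
      linear_combination -this
    rcases mul_eq_zero.1 h2 with h3 | h3
    · exact h3
    · have := (sin_pos_of_phi h0 h1).ne'
      simp [-ofReal_sin, this] at h3
  · intro h
    apply su2_ext
    · rw [mul_zero_zero, mul_zero_zero, h]; simp [mul_comm]
    · rw [mul_one_zero, mul_one_zero, h]; simp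

lemma commute_of_one_zero {U V : SU2} (hU : U.1 1 0 = 0) (hV : V.1 1 0 = 0) :
    U * V = V * U := by
  apply su2_ext
  · rw [mul_zero_zero, mul_zero_zero, hU, hV]; simp [mul_comm]
  · rw [mul_one_zero, mul_one_zero, hU, hV]; simp

lemma phi_pos_lt {U : SU2} (h : ¬ (phi U = 0 ∨ phi U = 1 / 2)) : 0 < phi U ∧ phi U < 1 / 2 := by
  push Not at h
  exact ⟨lt_of_le_of_ne (phi_nonneg U) h.1.symm, lt_of_le_of_ne (phi_le_half U) h.2⟩

lemma conj_commute_iff (k U V : SU2) : (k * U * k⁻¹) * V = V * (k * U * k⁻¹) ↔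
    U * (k⁻¹ * V * k) = (k⁻¹ * V * k) * U := by
  constructor
  · intro h
    have := congrArg (fun x => k⁻¹ * x * k) h
    simpa [mul_assoc] using this
  · intro h
    have := congrArg (fun x => k * x * k⁻¹) h
    simpa [mul_assoc] using this

/-- The centraliser of a non-central element of `SU(2)` is commutative. -/
lemma commute_of_commute {U V W : SU2} (h : ¬ (phi U = 0 ∨ phi U = 1 / 2))
    (hV : U * V = V * U) (hW : U * W = W * U) : V * W = W * V := by
  obtain ⟨h0, h1⟩ := phi_pos_lt h
  obtain ⟨k, hk⟩ := exists_diagonalization U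
  rw [hk, conj_commute_iff, torusElement_mul_comm_iff h0 h1] at hV hW
  have := congrArg (fun x => k * x * k⁻¹) (commute_of_one_zero hV hW)
  simpa [mul_assoc] using this

lemma exists_not_commute : ∃ U V : SU2, U * V ≠ V * U := by
  refine ⟨torusElement (1 / 4), ofPair 0 1 (by simp), fun h => ?_⟩
  rw [torusElement_mul_comm_iff (by norm_num) (by norm_num)] at h
  simp at h

/-- The centre of `SU(2)` consists of the elements of phase `0` and `1/2`. -/
lemma mem_center_iff (U : SU2) : U ∈ Subgroup.center SU2 ↔ phi U = 0 ∨ phi U = 1 / 2 := by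
  rw [Subgroup.mem_center_iff]
  constructor
  · intro h
    by_contra hc
    obtain ⟨V, W, hVW⟩ := exists_not_commute
    exact hVW (commute_of_commute hc (h V).symm (h W).symm)
  · intro h V
    exact (commute_of_phi h V).symm

lemma phi_rational_of_zpow_eq_one {U : SU2} {N : ℤ} (hN : N ≠ 0) (h : U ^ N = 1) :
    ∃ r : ℚ, phi U = r := by
  obtain ⟨k, hk⟩ := exists_diagonalization U
  rw [hk, conj_zpow, mul_inv_eq_one, mul_eq_left, torusElement_zpow,
    torusElement_eq_one_iff] at h
  obtain ⟨m, hm⟩ := h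
  refine ⟨m / N, ?_⟩
  have : (N : ℝ) ≠ 0 := by exact_mod_cast hN
  push_cast
  rw [← hm]; field_simp

/-! ### Triangles of phases -/

/-- The weak triangle inequalities for three phases. -/
def Tri (u x y : ℝ) : Prop := u - x ≤ y ∧ x - u ≤ y ∧ y ≤ u + x ∧ u + x + y ≤ 1

/-- The strict triangle inequalities for three phases. -/
def StrictTri (u x y : ℝ) : Prop := u - x < y ∧ x - u < y ∧ y < u + x ∧ u + x + y < 1

lemma cos_le_cos_iff {s t : ℝ} (hs : s ∈ Set.Icc (0 : ℝ) (1 / 2))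
    (ht : t ∈ Set.Icc (0 : ℝ) (1 / 2)) :
    Real.cos (2 * Real.pi * s) ≤ Real.cos (2 * Real.pi * t) ↔ t ≤ s := by
  have hp := Real.pi_pos
  obtain ⟨hs0, hs1⟩ := hs
  obtain ⟨ht0, ht1⟩ := ht
  rw [Real.strictAntiOn_cos.le_iff_ge (a := 2 * Real.pi * s) (b := 2 * Real.pi * t)
    ⟨by positivity, by nlinarith⟩ ⟨by positivity, by nlinarith⟩]
  exact mul_le_mul_iff_right₀ (by positivity)

lemma cos_lt_cos_iff {s t : ℝ} (hs : s ∈ Set.Icc (0 : ℝ) (1 / 2))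
    (ht : t ∈ Set.Icc (0 : ℝ) (1 / 2)) :
    Real.cos (2 * Real.pi * s) < Real.cos (2 * Real.pi * t) ↔ t < s := by
  rw [← not_le, ← not_le, cos_le_cos_iff ht hs]

lemma cos_two_pi_one_sub (s : ℝ) :
    Real.cos (2 * Real.pi * (1 - s)) = Real.cos (2 * Real.pi * s) := by
  rw [mul_sub, mul_one, Real.cos_two_pi_sub]

lemma cos_two_pi_abs (s : ℝ) :
    Real.cos (2 * Real.pi * |s|) = Real.cos (2 * Real.pi * s) := by
  rcases abs_choice s with h | h <;> rw [h]
  rw [mul_neg, Real.cos_neg]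

/-- The inequalities amount to `|u - x| ≤ y ≤ min (u + x) (1 - u - x)`, and `cos (2 π ·)` is
decreasing on `[0, 1/2]` and symmetric about `1/2`. In this form they can be compared with traces.
-/
lemma tri_iff_cos {u x y : ℝ} (hu : u ∈ Set.Icc (0 : ℝ) (1 / 2))
    (hx : x ∈ Set.Icc (0 : ℝ) (1 / 2)) (hy : y ∈ Set.Icc (0 : ℝ) (1 / 2)) :
    Tri u x y ↔ Real.cos (2 * Real.pi * (u + x)) ≤ Real.cos (2 * Real.pi * y) ∧
      Real.cos (2 * Real.pi * y) ≤ Real.cos (2 * Real.pi * (u - x)) := by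
  have hux : |u - x| ∈ Set.Icc (0 : ℝ) (1 / 2) :=
    ⟨abs_nonneg _, abs_le.2 ⟨by linarith [hu.1, hx.2], by linarith [hu.2, hx.1]⟩⟩
  rw [← cos_two_pi_abs (u - x), cos_le_cos_iff hy hux, abs_le]
  obtain ⟨hu0, hu1⟩ := hu
  obtain ⟨hx0, hx1⟩ := hx
  obtain ⟨hy0, hy1⟩ := id hy
  rcases le_total (u + x) (1 / 2) with h | h
  · rw [cos_le_cos_iff ⟨by linarith, h⟩ hy]
    unfold Tri
    constructor
    · rintro ⟨h1, h2, h3, h4⟩; exact ⟨h3, by linarith, by linarith⟩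
    · rintro ⟨h1, h2, h3⟩; exact ⟨by linarith, by linarith, h1, by linarith⟩
  · rw [← cos_two_pi_one_sub, cos_le_cos_iff ⟨by linarith, by linarith⟩ hy]
    unfold Tri
    constructor
    · rintro ⟨h1, h2, h3, h4⟩; exact ⟨by linarith, by linarith, by linarith⟩
    · rintro ⟨h1, h2, h3⟩; exact ⟨by linarith, by linarith, by linarith, by linarith⟩

lemma strictTri_iff_cos {u x y : ℝ} (hu : u ∈ Set.Icc (0 : ℝ) (1 / 2))
    (hx : x ∈ Set.Icc (0 : ℝ) (1 / 2)) (hy : y ∈ Set.Icc (0 : ℝ) (1 / 2)) :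
    StrictTri u x y ↔ Real.cos (2 * Real.pi * (u + x)) < Real.cos (2 * Real.pi * y) ∧
      Real.cos (2 * Real.pi * y) < Real.cos (2 * Real.pi * (u - x)) := by
  have hux : |u - x| ∈ Set.Icc (0 : ℝ) (1 / 2) :=
    ⟨abs_nonneg _, abs_le.2 ⟨by linarith [hu.1, hx.2], by linarith [hu.2, hx.1]⟩⟩
  rw [← cos_two_pi_abs (u - x), cos_lt_cos_iff hy hux, abs_lt]
  obtain ⟨hu0, hu1⟩ := hu
  obtain ⟨hx0, hx1⟩ := hx
  obtain ⟨hy0, hy1⟩ := id hy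
  rcases le_total (u + x) (1 / 2) with h | h
  · rw [cos_lt_cos_iff ⟨by linarith, h⟩ hy]
    unfold StrictTri
    constructor
    · rintro ⟨h1, h2, h3, h4⟩; exact ⟨h3, by linarith, by linarith⟩
    · rintro ⟨h1, h2, h3⟩; exact ⟨by linarith, by linarith, h1, by linarith⟩
  · rw [← cos_two_pi_one_sub, cos_lt_cos_iff ⟨by linarith, by linarith⟩ hy]
    unfold StrictTri
    constructor
    · rintro ⟨h1, h2, h3, h4⟩; exact ⟨by linarith, by linarith, by linarith⟩
    · rintro ⟨h1, h2, h3⟩; exact ⟨by linarith, by linarith, by linarith, by linarith⟩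

lemma phi_mem (U : SU2) : phi U ∈ Set.Icc (0 : ℝ) (1 / 2) := ⟨phi_nonneg U, phi_le_half U⟩

lemma Tri.mem {u x y : ℝ} (h : Tri u x y) : u ∈ Set.Icc (0 : ℝ) (1 / 2) ∧
    x ∈ Set.Icc (0 : ℝ) (1 / 2) ∧ y ∈ Set.Icc (0 : ℝ) (1 / 2) := by
  obtain ⟨h1, h2, h3, h4⟩ := h
  refine ⟨⟨?_, ?_⟩, ⟨?_, ?_⟩, ⟨?_, ?_⟩⟩ <;> linarith

lemma StrictTri.tri {u x y : ℝ} (h : StrictTri u x y) : Tri u x y :=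
  ⟨h.1.le, h.2.1.le, h.2.2.1.le, h.2.2.2.le⟩

lemma re_torusElement_mul (u : ℝ) (a : SU2) : ((torusElement u * a).1 0 0).re =
    Real.cos (2 * Real.pi * u) * (a.1 0 0).re - Real.sin (2 * Real.pi * u) * (a.1 0 0).im := by
  rw [mul_zero_zero, torusElement_zero_zero_eq, torusElement_one_zero]
  simp [-ofReal_cos, -ofReal_sin]

lemma im_sq_add_normSq (a : SU2) : (a.1 0 0).im ^ 2 + normSq (a.1 1 0) =
    Real.sin (2 * Real.pi * phi a) ^ 2 := by
  have h := normSq_add_normSq a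
  have h' := Real.sin_sq_add_cos_sq (2 * Real.pi * phi a)
  rw [cos_phi] at h'
  rw [normSq_apply] at h
  linarith

lemma phi_mul_conj (k U a : SU2) :
    phi ((k * U * k⁻¹) * a) = phi (U * (k⁻¹ * a * k)) := by
  rw [← phi_conj k (U * (k⁻¹ * a * k))]
  congr 1
  group

/-- The trace of the product is affine in the imaginary part of the diagonal entry of `a`, which is
bounded by the sine of the phase of `a`. The two extremes are the addition formulas for the cosine.
-/
lemma tri_torusElement {u : ℝ} (hu : u ∈ Set.Icc (0 : ℝ) (1 / 2)) (a : SU2) :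
    Tri u (phi a) (phi (torusElement u * a)) := by
  have hs : 0 ≤ Real.sin (2 * Real.pi * u) := by
    have := sin_phi_nonneg (torusElement u); rwa [phi_torusElement hu.1 hu.2] at this
  rw [tri_iff_cos hu (phi_mem a) (phi_mem _), cos_phi, re_torusElement_mul, ← cos_phi a,
    mul_add, mul_sub, Real.cos_add, Real.cos_sub]
  have hi : |(a.1 0 0).im| ≤ Real.sin (2 * Real.pi * phi a) :=
    abs_le_of_sq_le_sq (by linarith [im_sq_add_normSq a, normSq_nonneg (a.1 1 0)])
      (sin_phi_nonneg a)
  rw [abs_le] at hi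
  constructor <;> nlinarith

/-- The phases of two elements and of their product satisfy the triangle inequalities. -/
lemma tri_mul (U a : SU2) : Tri (phi U) (phi a) (phi (U * a)) := by
  obtain ⟨k, hk⟩ := exists_diagonalization U
  have h := tri_torusElement (phi_mem U) (k⁻¹ * a * k)
  rwa [phi_conj', ← phi_mul_conj, ← hk] at h

/-- Equality in the bound on the imaginary part means that the off-diagonal entry of `a` vanishes,
which for non-central `torusElement u` is commutation. -/
lemma strictTri_torusElement_iff {u : ℝ} (hu : u ∈ Set.Icc (0 : ℝ) (1 / 2)) (a : SU2) :
    StrictTri u (phi a) (phi (torusElement u * a)) ↔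
      torusElement u * a ≠ a * torusElement u := by
  rw [strictTri_iff_cos hu (phi_mem a) (phi_mem _), cos_phi, re_torusElement_mul, ← cos_phi a,
    mul_add, mul_sub, Real.cos_add, Real.cos_sub]
  by_cases hc : u = 0 ∨ u = 1 / 2
  · have hs : Real.sin (2 * Real.pi * u) = 0 := by
      rcases hc with rfl | rfl
      · simp
      · rw [show 2 * Real.pi * (1 / 2) = Real.pi by ring, Real.sin_pi]
    have h2 : torusElement u * a = a * torusElement u := by
      apply commute_of_phi
      rwa [phi_torusElement hu.1 hu.2]
    simp [hs, h2]
  · push Not at hc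
    have h0 := lt_of_le_of_ne hu.1 hc.1.symm
    have h1 := lt_of_le_of_ne hu.2 hc.2
    have hs := sin_pos_of_phi h0 h1
    have hx := sin_phi_nonneg a
    have hi := im_sq_add_normSq a
    rw [Ne, torusElement_mul_comm_iff h0 h1, ← normSq_eq_zero]
    constructor
    · rintro ⟨h3, h4⟩ h5
      rw [h5, add_zero, sq_eq_sq_iff_abs_eq_abs, abs_of_nonneg hx] at hi
      rcases abs_choice (a.1 0 0).im with h6 | h6 <;> rw [h6] at hi <;> nlinarith
    · intro h5
      have h6 : 0 < normSq (a.1 1 0) := lt_of_le_of_ne (normSq_nonneg _) (Ne.symm h5)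
      have h7 : |(a.1 0 0).im| < Real.sin (2 * Real.pi * phi a) :=
        abs_lt_of_sq_lt_sq (by linarith) hx
      rw [abs_lt] at h7
      constructor <;> nlinarith

/-- Two elements of `SU(2)` commute precisely if their triangle of phases is degenerate. -/
lemma strictTri_mul_iff (U a : SU2) :
    StrictTri (phi U) (phi a) (phi (U * a)) ↔ U * a ≠ a * U := by
  obtain ⟨k, hk⟩ := exists_diagonalization U
  have h := strictTri_torusElement_iff (phi_mem U) (k⁻¹ * a * k)
  rw [phi_conj', ← phi_mul_conj, ← hk, Ne, ← conj_commute_iff, ← hk] at h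
  exact h

lemma exists_of_tri_torusElement {u x y : ℝ} (h : Tri u x y) :
    ∃ a, phi a = x ∧ phi (torusElement u * a) = y := by
  obtain ⟨hu, hx, hy⟩ := h.mem
  rw [tri_iff_cos hu hx hy] at h
  -- `f t` is half the trace of the product when `a` has phase `x` and its axis makes angle `t` with
  -- that of the torus. It runs from `cos (2 π (u + x))` to `cos (2 π (u - x))`.
  let f : ℝ → ℝ := fun t => Real.cos (2 * Real.pi * u) * Real.cos (2 * Real.pi * x) -
    Real.sin (2 * Real.pi * u) * (Real.sin (2 * Real.pi * x) * Real.cos t)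
  have hf : ContinuousOn f (Set.Icc 0 Real.pi) := by fun_prop
  obtain ⟨t, -, ht⟩ := intermediate_value_Icc Real.pi_pos.le hf
    (show Real.cos (2 * Real.pi * y) ∈ Set.Icc (f 0) (f Real.pi) by
      rw [mul_add, mul_sub, Real.cos_add, Real.cos_sub] at h
      simp only [f, Real.cos_zero, Real.cos_pi]
      constructor <;> linarith [h.1, h.2])
  have hn : normSq (⟨Real.cos (2 * Real.pi * x), Real.sin (2 * Real.pi * x) * Real.cos t⟩ : ℂ) +
      normSq ((Real.sin (2 * Real.pi * x) * Real.sin t : ℝ) : ℂ) = 1 := by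
    rw [normSq_apply, normSq_ofReal]
    have h1 := Real.sin_sq_add_cos_sq (2 * Real.pi * x)
    have h2 := Real.sin_sq_add_cos_sq t
    simp only
    linear_combination h1 + Real.sin (2 * Real.pi * x) ^ 2 * h2
  refine ⟨ofPair _ _ hn, ?_, ?_⟩
  · rw [phi_eq_iff _ hx.1 hx.2, ofPair_zero_zero]
  · rw [phi_eq_iff _ hy.1 hy.2, re_torusElement_mul, ofPair_zero_zero]
    exact ht

/-- Every triangle of phases is realised. -/
lemma exists_of_tri {U : SU2} {x y : ℝ} (h : Tri (phi U) x y) :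
    ∃ a, phi a = x ∧ phi (U * a) = y := by
  obtain ⟨k, hk⟩ := exists_diagonalization U
  obtain ⟨a, ha, ha'⟩ := exists_of_tri_torusElement h
  refine ⟨k * a * k⁻¹, by rw [phi_conj, ha], ?_⟩
  rw [hk, phi_mul_conj, ← ha']
  congr 2
  group

/-! ### Connectedness of subsets of `SU(2)` -/

lemma exists_conj_of_phi_eq {U V : SU2} (h : phi U = phi V) : ∃ k, V = k * U * k⁻¹ := by
  obtain ⟨k, hk⟩ := exists_diagonalization U
  obtain ⟨l, hl⟩ := exists_diagonalization V
  refine ⟨l * k⁻¹, ?_⟩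
  have : l * k⁻¹ * U * (l * k⁻¹)⁻¹ = l * (k⁻¹ * U * k) * l⁻¹ := by group
  have hk' : k⁻¹ * U * k = torusElement (phi U) := by nth_rw 1 [hk]; group
  rw [this, hl, ← h, hk']

lemma isPreconnected_class (x : ℝ) : IsPreconnected {a : SU2 | phi a = x} := by
  rcases Set.eq_empty_or_nonempty {a : SU2 | phi a = x} with h | ⟨a, ha⟩
  · rw [h]; exact isPreconnected_empty
  · have : {a : SU2 | phi a = x} = Set.range fun k : SU2 => k * a * k⁻¹ := by
      ext b
      constructor
      · intro hb
        obtain ⟨k, hk⟩ := exists_conj_of_phi_eq (U := a) (V := b) (ha.trans hb.symm)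
        exact ⟨k, hk.symm⟩
      · rintro ⟨k, rfl⟩
        exact (phi_conj k a).trans ha
    rw [this]
    exact isPreconnected_range (by fun_prop)

lemma exists_eq_torusElement {d : SU2} (h : d.1 1 0 = 0) : ∃ s, d = torusElement s := by
  have hn := normSq_add_normSq d
  rw [h, map_zero, add_zero] at hn
  obtain ⟨s, hs⟩ := exists_polar (d.1 0 0) (r := 1) (by rw [hn]; norm_num) zero_le_one
  have hp := Real.pi_ne_zero
  refine ⟨s / (2 * Real.pi), su2_ext ?_ h⟩
  rw [hs, torusElement_zero_zero, ofReal_one, one_mul, ← ofReal_ofNat, ← ofReal_mul,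
    ← ofReal_mul, mul_div_cancel₀ _ (by positivity)]

lemma continuous_torusElement : Continuous torusElement := by
  have h : torusElement = fun θ : ℝ => ofPair (Complex.exp (2 * Real.pi * θ * Complex.I)) 0 (by
      have := normSq_add_normSq (torusElement θ)
      rwa [torusElement_zero_zero, torusElement_one_zero] at this) := by
    funext θ; exact su2_ext rfl rfl
  rw [h]
  exact continuous_ofPair (by fun_prop) (by fun_prop) _

/-- The centraliser is all of `SU(2)` or a conjugate of the diagonal torus. -/
lemma isPreconnected_centralizer (c : SU2) : IsPreconnected {d : SU2 | d * c = c * d} := by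
  by_cases h : phi c = 0 ∨ phi c = 1 / 2
  · have : {d : SU2 | d * c = c * d} = Set.univ :=
      Set.eq_univ_of_forall fun d => (commute_of_phi h d).symm
    rw [this]; exact isPreconnected_univ
  · obtain ⟨h0, h1⟩ := phi_pos_lt h
    obtain ⟨k, hk⟩ := exists_diagonalization c
    have : {d : SU2 | d * c = c * d} = Set.range fun s : ℝ => k * torusElement s * k⁻¹ := by
      ext d
      change d * c = c * d ↔ _
      rw [eq_comm, hk, conj_commute_iff, torusElement_mul_comm_iff h0 h1]
      constructor
      · intro hd
        obtain ⟨s, hs⟩ := exists_eq_torusElement hd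
        refine ⟨s, ?_⟩
        simp only
        rw [← hs]; group
      · rintro ⟨s, rfl⟩
        have : k⁻¹ * (k * torusElement s * k⁻¹) * k = torusElement s := by group
        rw [this, torusElement_one_zero]
    rw [this]
    have := continuous_torusElement
    exact isPreconnected_range (by fun_prop)

lemma isPreconnected_intertwiner (c c' : SU2) : IsPreconnected {d : SU2 | d * c = c' * d} := by
  rcases Set.eq_empty_or_nonempty {d : SU2 | d * c = c' * d} with h | ⟨e, he⟩
  · rw [h]; exact isPreconnected_empty
  · have he : e * c = c' * e := he
    have hc : c' = e * c * e⁻¹ := by rw [he]; group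
    have : {d : SU2 | d * c = c' * d} = (fun d => e * d) '' {d : SU2 | d * c = c * d} := by
      ext d
      constructor
      · intro (hd : d * c = c' * d)
        refine ⟨e⁻¹ * d, ?_, by simp⟩
        change e⁻¹ * d * c = c * (e⁻¹ * d)
        rw [mul_assoc, hd, hc]; group
      · rintro ⟨d, hd, rfl⟩
        change e * d * c = c' * (e * d)
        rw [mul_assoc, (hd : d * c = c * d), ← mul_assoc, he, mul_assoc]
    rw [this]
    exact (isPreconnected_centralizer c).image _ (by fun_prop)

/-- Off the centre the two traces fix the upper left entry of `a` and the modulus of the lower left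
one, so only an argument is free. For central `torusElement u` the second condition is vacuous once
one solution exists, and the set is a conjugacy class. -/
lemma isPreconnected_circle_torusElement {u : ℝ} (hu : u ∈ Set.Icc (0 : ℝ) (1 / 2)) (x y : ℝ) :
    IsPreconnected {a : SU2 | phi a = x ∧ phi (torusElement u * a) = y} := by
  rcases Set.eq_empty_or_nonempty {a : SU2 | phi a = x ∧ phi (torusElement u * a) = y} with
    h | ⟨e, he, he'⟩
  · rw [h]; exact isPreconnected_empty
  subst he he'
  have hset (a : SU2) (ha : phi a = phi e) : phi (torusElement u * a) = phi (torusElement u * e) ↔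
      Real.sin (2 * Real.pi * u) * (a.1 0 0).im = Real.sin (2 * Real.pi * u) * (e.1 0 0).im := by
    rw [phi_eq_phi_iff, re_torusElement_mul, re_torusElement_mul, (phi_eq_phi_iff a e).1 ha]
    constructor <;> intro h <;> linarith
  by_cases hc : u = 0 ∨ u = 1 / 2
  · have hs : Real.sin (2 * Real.pi * u) = 0 := by
      rcases hc with rfl | rfl
      · simp
      · rw [show 2 * Real.pi * (1 / 2) = Real.pi by ring, Real.sin_pi]
    have : {a : SU2 | phi a = phi e ∧ phi (torusElement u * a) = phi (torusElement u * e)} =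
        {a | phi a = phi e} := by
      ext a
      refine ⟨fun h => h.1, fun h => ⟨h, (hset a h).2 ?_⟩⟩
      rw [hs, zero_mul, zero_mul]
    rw [this]
    exact isPreconnected_class _
  · push Not at hc
    have hs := sin_pos_of_phi (lt_of_le_of_ne hu.1 hc.1.symm) (lt_of_le_of_ne hu.2 hc.2)
    set r := √(normSq (e.1 1 0)) with hr
    have hrr : r ^ 2 = normSq (e.1 1 0) := Real.sq_sqrt (normSq_nonneg _)
    have hn (s : ℝ) : normSq (e.1 0 0) + normSq (r * Complex.exp (s * Complex.I)) = 1 := by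
      rw [normSq_mul_exp, hrr, normSq_add_normSq]
    have : {a : SU2 | phi a = phi e ∧ phi (torusElement u * a) = phi (torusElement u * e)} =
        Set.range fun s : ℝ => ofPair _ _ (hn s) := by
      ext a
      constructor
      · rintro ⟨h1, h2⟩
        rw [hset a h1, mul_right_inj' hs.ne'] at h2
        have hz : a.1 0 0 = e.1 0 0 := Complex.ext ((phi_eq_phi_iff a e).1 h1) h2
        have hw := normSq_add_normSq a
        rw [hz] at hw
        obtain ⟨s, hs⟩ := exists_polar (a.1 1 0) (r := r)
          (by linarith [normSq_add_normSq e]) (Real.sqrt_nonneg _)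
        exact ⟨s, su2_ext hz.symm hs.symm⟩
      · rintro ⟨s, rfl⟩
        have h1 : phi (ofPair _ _ (hn s)) = phi e := by
          rw [phi_eq_phi_iff, ofPair_zero_zero]
        refine ⟨h1, (hset _ h1).2 ?_⟩
        rw [ofPair_zero_zero]
    rw [this]
    exact isPreconnected_range (continuous_ofPair (by fun_prop) (by fun_prop) _)

/-- The elements `a` with prescribed phases of `a` and of `U a` form a connected set. -/
lemma isPreconnected_circle (U : SU2) (x y : ℝ) :
    IsPreconnected {a : SU2 | phi a = x ∧ phi (U * a) = y} := by
  obtain ⟨k, hk⟩ := exists_diagonalization U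
  have : {a : SU2 | phi a = x ∧ phi (U * a) = y} = (fun a => k * a * k⁻¹) ''
      {a : SU2 | phi a = x ∧ phi (torusElement (phi U) * a) = y} := by
    ext a
    constructor
    · rintro ⟨h1, h2⟩
      refine ⟨k⁻¹ * a * k, ⟨by rw [phi_conj', h1], ?_⟩, by group⟩
      rw [← phi_mul_conj, ← hk, h2]
    · rintro ⟨a, ⟨h1, h2⟩, rfl⟩
      refine ⟨by rw [phi_conj, h1], ?_⟩
      rw [hk, phi_mul_conj, ← h2]
      congr 2
      group
  rw [this]
  exact (isPreconnected_circle_torusElement (phi_mem U) x y).image _ (by fun_prop)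

end ComplexCoordinates

/-! ### Connectedness of spaces of holonomies -/

/-- A compact set is connected if it maps continuously to a connected set with connected fibres. -/
lemma isPreconnected_of_fibers {X Y : Type*} [TopologicalSpace X] [TopologicalSpace Y] [T2Space Y]
    {K : Set X} (hK : IsCompact K) {f : X → Y} (hf : Continuous f)
    (him : IsPreconnected (f '' K)) (hfib : ∀ y, IsPreconnected (K ∩ f ⁻¹' {y})) :
    IsPreconnected K := by
  rw [isPreconnected_closed_iff]
  intro t t' ht ht' hsub hne hne'
  -- By compactness the images of the two closed pieces are closed; they cover the connected image,
  -- so they share a point, and the fibre over it meets both pieces.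
  have hc : IsClosed (f '' (K ∩ t)) := ((hK.inter_right ht).image hf).isClosed
  have hc' : IsClosed (f '' (K ∩ t')) := ((hK.inter_right ht').image hf).isClosed
  obtain ⟨y, -, ⟨x, hx, rfl⟩, ⟨x', hx', hxx'⟩⟩ := isPreconnected_closed_iff.1 him _ _ hc hc'
    (by
      rw [← Set.image_union, ← Set.inter_union_distrib_left]
      exact Set.image_mono fun x hx => ⟨hx, hsub hx⟩)
    (by
      obtain ⟨x, hx⟩ := hne
      exact ⟨f x, ⟨x, hx.1, rfl⟩, ⟨x, hx, rfl⟩⟩)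
    (by
      obtain ⟨x, hx⟩ := hne'
      exact ⟨f x, ⟨x, hx.1, rfl⟩, ⟨x, hx, rfl⟩⟩)
  obtain ⟨z, hz, hz'⟩ := isPreconnected_closed_iff.1 (hfib (f x)) t t' ht ht'
    (fun z hz => hsub hz.1) ⟨x, ⟨hx.1, rfl⟩, hx.2⟩ ⟨x', ⟨hx'.1, hxx'⟩, hx'.2⟩
  exact ⟨z, hz.1, hz'⟩

/-- A map `f` to `SU(2)` from a compact set `K` such that the phase of `f` takes an interval of
values on `K`, with connected level sets. -/
structure ConnectedLevels {X : Type*} [TopologicalSpace X] (K : Set X) (f : X → SU2) : Prop where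
  isCompact : IsCompact K
  continuous : Continuous f
  fiber : ∀ y, IsPreconnected {x | x ∈ K ∧ phi (f x) = y}
  convex : Convex ℝ ((fun x => phi (f x)) '' K)

/-- The induction step for one more factor. `R` is the set of pairs (old phase, new phase) that
occur. A level set of the new phase has connected fibres over its projection to `X`; that projection
in turn has connected fibres over a slice of `R`, an interval by convexity. -/
lemma ConnectedLevels.prod {X Y : Type*} [TopologicalSpace X] [T2Space X] [TopologicalSpace Y] {K : Set X}
    {f : X → SU2} (hf : ConnectedLevels K f) {L : Set Y} (hL : IsCompact L) {h : SU2 → Y → SU2}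
    (hh : Continuous fun v : SU2 × Y => h v.1 v.2) {R : Set (ℝ × ℝ)} (hR : Convex ℝ R)
    (hfib : ∀ U t, IsPreconnected {y | y ∈ L ∧ phi (h U y) = t})
    (hne : ∀ U t, (∃ y ∈ L, phi (h U y) = t) ↔ (phi U, t) ∈ R) :
    ConnectedLevels (K ×ˢ L) (fun v : X × Y => h (f v.1) v.2) := by
  have hcf := hf.continuous
  have hcont : Continuous fun v : X × Y => h (f v.1) v.2 :=
    hh.comp (f := fun v : X × Y => (f v.1, v.2)) (by fun_prop)
  have hphi := continuous_phi
  refine ⟨hf.isCompact.prod hL, hcont, fun t => ?_, ?_⟩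
  · have hc : IsCompact {v : X × Y | v ∈ K ×ˢ L ∧ phi (h (f v.1) v.2) = t} :=
      (hf.isCompact.prod hL).inter_right (isClosed_eq (hphi.comp hcont) continuous_const)
    have him : Prod.fst '' {v : X × Y | v ∈ K ×ˢ L ∧ phi (h (f v.1) v.2) = t} =
        {x | x ∈ K ∧ (phi (f x), t) ∈ R} := by
      ext x
      constructor
      · rintro ⟨v, ⟨hv, hv'⟩, rfl⟩
        exact ⟨hv.1, (hne _ _).1 ⟨v.2, hv.2, hv'⟩⟩
      · rintro ⟨hx, hx'⟩
        obtain ⟨y, hy, hy'⟩ := (hne _ _).2 hx'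
        exact ⟨(x, y), ⟨⟨hx, hy⟩, hy'⟩, rfl⟩
    have hbase : IsPreconnected {x | x ∈ K ∧ (phi (f x), t) ∈ R} := by
      refine isPreconnected_of_fibers (f := fun x => phi (f x)) ?_ (hphi.comp hcf) ?_ ?_
      · rw [← him]; exact hc.image continuous_fst
      · have : (fun x => phi (f x)) '' {x | x ∈ K ∧ (phi (f x), t) ∈ R} =
            ((fun x => phi (f x)) '' K) ∩ (fun s => (s, t)) ⁻¹' R := by
          ext s
          constructor
          · rintro ⟨x, ⟨hx, hx'⟩, rfl⟩
            exact ⟨⟨x, hx, rfl⟩, hx'⟩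
          · rintro ⟨⟨x, hx, rfl⟩, hx'⟩
            exact ⟨x, ⟨hx, hx'⟩, rfl⟩
        rw [this]
        refine (hf.convex.inter ?_).isPreconnected
        intro s hs s' hs' a b ha hb hab
        have := hR hs hs' ha hb hab
        simp only [Prod.smul_mk, Prod.mk_add_mk, ← add_smul, hab, one_smul] at this
        exact this
      · intro s
        by_cases hs : (s, t) ∈ R
        · convert hf.fiber s using 1
          ext x
          constructor
          · rintro ⟨⟨hx, hx'⟩, h2⟩
            exact ⟨hx, h2⟩
          · rintro ⟨hx, rfl⟩
            exact ⟨⟨hx, hs⟩, rfl⟩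
        · convert isPreconnected_empty
          rw [Set.eq_empty_iff_forall_notMem]
          rintro x ⟨⟨-, h1⟩, rfl⟩
          exact hs h1
    refine isPreconnected_of_fibers hc continuous_fst (him ▸ hbase) fun x => ?_
    by_cases hx : x ∈ K
    · convert (hfib (f x) t).image (fun y => (x, y)) (by fun_prop) using 1
      ext ⟨x', y⟩
      constructor
      · rintro ⟨⟨⟨-, hy⟩, h2⟩, rfl⟩
        exact ⟨y, ⟨hy, h2⟩, rfl⟩
      · rintro ⟨y, ⟨hy, h2⟩, heq⟩
        obtain ⟨rfl, rfl⟩ := Prod.mk.inj heq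
        exact ⟨⟨⟨hx, hy⟩, h2⟩, rfl⟩
    · convert isPreconnected_empty
      rw [Set.eq_empty_iff_forall_notMem]
      rintro ⟨x', y⟩ ⟨⟨⟨h1, -⟩, -⟩, rfl⟩
      exact hx h1
  · have : (fun v : X × Y => phi (h (f v.1) v.2)) '' (K ×ˢ L) =
        Prod.snd '' (R ∩ (((fun x => phi (f x)) '' K) ×ˢ Set.univ)) := by
      ext t
      constructor
      · rintro ⟨v, hv, rfl⟩
        exact ⟨(phi (f v.1), _), ⟨(hne _ _).1 ⟨v.2, hv.2, rfl⟩, ⟨v.1, hv.1, rfl⟩, trivial⟩, rfl⟩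
      · rintro ⟨⟨-, t⟩, ⟨hr, ⟨x, hx, rfl⟩, -⟩, rfl⟩
        obtain ⟨y, hy, hy'⟩ := (hne _ _).2 hr
        exact ⟨(x, y), ⟨hx, hy⟩, hy'⟩
    rw [this]
    exact (hR.inter (hf.convex.prod convex_univ)).is_linear_image (f := Prod.snd) ⟨fun _ _ => rfl, fun _ _ => rfl⟩

/-- Used to reassemble a pair (initial tuple, last entry) into a tuple. -/
lemma ConnectedLevels.image {X Y : Type*} [TopologicalSpace X] [TopologicalSpace Y] {K : Set X}
    {f : X → SU2} (hf : ConnectedLevels K f) {e : X → Y} (he : Continuous e) {f' : Y → SU2}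
    (hf' : Continuous f') (hfe : ∀ x, f' (e x) = f x) {K' : Set Y} (hK' : e '' K = K') :
    ConnectedLevels K' f' := by
  subst hK'
  refine ⟨hf.isCompact.image he, hf', fun t => ?_, ?_⟩
  · convert (hf.fiber t).image e he.continuousOn using 1
    ext y
    constructor
    · rintro ⟨⟨x, hx, rfl⟩, h2⟩
      exact ⟨x, ⟨hx, hfe x ▸ h2⟩, rfl⟩
    · rintro ⟨x, ⟨hx, h2⟩, rfl⟩
      exact ⟨⟨x, hx, rfl⟩, (hfe x).symm ▸ h2⟩
  · rw [Set.image_image]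
    simpa only [hfe] using hf.convex

lemma continuous_prod_ofFn {X : Type*} [TopologicalSpace X] {n : ℕ} {f : Fin n → X → SU2}
    (hf : ∀ j, Continuous (f j)) : Continuous fun x => (List.ofFn fun j => f j x).prod := by
  induction n with
  | zero => simpa using continuous_const
  | succ n ih =>
    simp only [List.ofFn_succ, List.prod_cons]
    exact (hf 0).mul (ih fun j => hf j.succ)

lemma prod_ofFn_snoc {G : Type*} [Monoid G] {n : ℕ} (f : Fin (n + 1) → G) :
    (List.ofFn f).prod = (List.ofFn fun j : Fin n => f j.castSucc).prod * f (Fin.last n) := by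
  rw [List.ofFn_succ', List.concat_eq_append, List.prod_append, List.prod_singleton]

lemma connectedLevels_classes {n : ℕ} (θ : Fin n → ℝ) :
    ConnectedLevels {a : Fin n → SU2 | ∀ j, phi (a j) = θ j} (fun a => (List.ofFn a).prod) := by
  have hphi := continuous_phi
  induction n with
  | zero =>
    exact ⟨(Set.toFinite _).isCompact, continuous_prod_ofFn fun j => j.elim0,
      fun t => (Set.subsingleton_of_subsingleton).isPreconnected,
      ((Set.subsingleton_of_subsingleton).image _).convex⟩
  | succ n ih =>
    -- The triangle inequalities with one side fixed are linear in the other two.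
    have hR : Convex ℝ {v : ℝ × ℝ | Tri v.1 (θ (Fin.last n)) v.2} := by
      rintro ⟨s, t⟩ ⟨h1, h2, h3, h4⟩ ⟨s', t'⟩ ⟨h1', h2', h3', h4'⟩ a b ha hb hab
      simp only at h1 h2 h3 h4 h1' h2' h3' h4'
      obtain rfl : a = 1 - b := by linarith
      simp only [Prod.smul_mk, Prod.mk_add_mk, smul_eq_mul, Set.mem_ofPred_eq, Tri]
      refine ⟨?_, ?_, ?_, ?_⟩ <;> nlinarith
    have h := (ih fun j => θ j.castSucc).prod (L := {a : SU2 | phi a = θ (Fin.last n)})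
      (h := fun U a => U * a) (isClosed_eq hphi continuous_const).isCompact
      continuous_mul hR (fun U t => isPreconnected_circle U _ t) (fun U t => by
        constructor
        · rintro ⟨a, ha, rfl⟩
          have := tri_mul U a
          rwa [(ha : phi a = _)] at this
        · exact fun ht => exists_of_tri ht)
    refine h.image (e := fun v => (Fin.snoc v.1 v.2 : Fin (n + 1) → SU2)) (by fun_prop)
      (continuous_prod_ofFn fun j => continuous_apply j) (fun v => ?_) ?_
    · rw [prod_ofFn_snoc]; simp
    · ext a
      constructor
      · rintro ⟨v, ⟨h1, h2⟩, rfl⟩ j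
        refine Fin.lastCases ?_ (fun j => ?_) j
        · simpa using h2
        · simpa using h1 j
      · intro ha
        exact ⟨(Fin.init a, a (Fin.last n)), ⟨fun j => ha _, ha _⟩, Fin.snoc_init_self a⟩

/-- Up to conjugation, multiplying by an inverse commutator means multiplying by `d` and then by `c
* d⁻¹ * c⁻¹`, which can be any element with the phase of `d`. Commutators thereby reduce to two
triangles that share the side `U * d`. -/
lemma phi_comm_inv_mul (c d U : SU2) :
    phi ((comm c d)⁻¹ * U) = phi (U * d * (c * d⁻¹ * c⁻¹)) := by
  rw [phi_mul_comm]
  congr 1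
  unfold comm
  group

lemma exists_commutator_phases {x t y : ℝ} {U d : SU2} (hd : phi d = x) (ht : phi (U * d) = t)
    (h : Tri t x y) : ∃ c, phi ((comm c d)⁻¹ * U) = y := by
  obtain ⟨e, he, he'⟩ := exists_of_tri (U := U * d) (ht ▸ h)
  obtain ⟨c, hc⟩ := exists_conj_of_phi_eq (U := d⁻¹) (V := e) (by rw [phi_inv, hd, he])
  exact ⟨c, by rw [phi_comm_inv_mul, ← hc, he']⟩

lemma exists_phi_comm_inv_mul (U : SU2) {y : ℝ} (hy : y ∈ Set.Icc (0 : ℝ) (1 / 2)) :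
    ∃ c d, phi ((comm c d)⁻¹ * U) = y := by
  have hU := phi_mem U
  -- With `d` and `U * d` both of phase `1/4`, the midpoint of the range, both triangles exist
  -- whatever the phase of `U` and the target `y`.
  obtain ⟨d, hd, hd'⟩ := exists_of_tri (U := U) (x := 1 / 4) (y := 1 / 4)
    ⟨by linarith [hU.2], by linarith [hU.1], by linarith [hU.1], by linarith [hU.2]⟩
  obtain ⟨c, hc⟩ := exists_commutator_phases hd hd' (y := y)
    ⟨by linarith [hy.1], by linarith [hy.1], by linarith [hy.2], by linarith [hy.2]⟩
  exact ⟨c, d, hc⟩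

/-- Every element of `SU(2)` is a commutator. -/
lemma exists_comm_eq (U : SU2) : ∃ c d, comm c d = U := by
  obtain ⟨c, d, h⟩ := exists_phi_comm_inv_mul U (y := 0) ⟨le_rfl, by norm_num⟩
  rw [phi_eq_zero_iff, inv_mul_eq_one] at h
  exact ⟨c, d, h⟩

/-- A tower of maps with connected fibres: from `(c, d)` to `(d, c * d⁻¹ * c⁻¹)`, with cosets of
centralisers as fibres; then to `d`; then to the phases of `d` and `U * d`. The last two have fibres
given by `isPreconnected_circle`, and the final image is convex, cut out by two triangle conditions.
-/
lemma isPreconnected_comm_level (U : SU2) (y : ℝ) :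
    IsPreconnected {v : SU2 × SU2 | phi ((comm v.1 v.2)⁻¹ * U) = y} := by
  have hphi := continuous_phi
  simp only [phi_comm_inv_mul]
  set K₁ := {v : SU2 × SU2 | phi (U * v.2 * (v.1 * v.2⁻¹ * v.1⁻¹)) = y} with hK₁
  set K₂ := {v : SU2 × SU2 | phi v.2 = phi v.1 ∧ phi (U * v.1 * v.2) = y} with hK₂
  set K₃ := {d : SU2 | Tri (phi (U * d)) (phi d) y} with hK₃
  set K₄ := {v : ℝ × ℝ | Tri (phi U) v.1 v.2 ∧ Tri v.2 v.1 y} with hK₄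
  have c₁ : IsCompact K₁ := (isClosed_eq (by fun_prop) continuous_const).isCompact
  have c₂ : IsCompact K₂ := ((isClosed_eq (by fun_prop) (by fun_prop)).inter
    (isClosed_eq (by fun_prop) continuous_const)).isCompact
  have f₁ : Continuous fun v : SU2 × SU2 => (v.2, v.1 * v.2⁻¹ * v.1⁻¹) := by fun_prop
  have f₃ : Continuous fun d : SU2 => (phi d, phi (U * d)) := by fun_prop
  have i₁ : (fun v : SU2 × SU2 => (v.2, v.1 * v.2⁻¹ * v.1⁻¹)) '' K₁ = K₂ := by
    ext ⟨d, e⟩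
    constructor
    · rintro ⟨⟨c, d⟩, hv, heq⟩
      obtain ⟨rfl, rfl⟩ := Prod.mk.inj heq
      exact ⟨by simp only; rw [phi_conj, phi_inv], hv⟩
    · rintro ⟨h1, h2⟩
      obtain ⟨c, rfl⟩ := exists_conj_of_phi_eq (U := d⁻¹) (V := e) (by rw [phi_inv, h1])
      exact ⟨(c, d), h2, rfl⟩
  have i₂ : Prod.fst '' K₂ = K₃ := by
    ext d
    constructor
    · rintro ⟨⟨d, e⟩, ⟨h1, h2⟩, rfl⟩
      have := tri_mul (U * d) e
      simp only at h1 h2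
      rwa [h1, h2] at this
    · intro hd
      obtain ⟨e, h1, h2⟩ := exists_of_tri hd
      exact ⟨(d, e), ⟨h1, h2⟩, rfl⟩
  have c₃ : IsCompact K₃ := i₂ ▸ c₂.image continuous_fst
  have i₃ : (fun d : SU2 => (phi d, phi (U * d))) '' K₃ = K₄ := by
    ext ⟨x, t⟩
    constructor
    · rintro ⟨d, hd, heq⟩
      obtain ⟨rfl, rfl⟩ := Prod.mk.inj heq
      exact ⟨tri_mul U d, hd⟩
    · rintro ⟨h1, h2⟩
      obtain ⟨d, rfl, rfl⟩ := exists_of_tri h1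
      exact ⟨d, h2, rfl⟩
  have p₄ : IsPreconnected K₄ := by
    refine Convex.isPreconnected ?_
    rintro ⟨s, t⟩ ⟨⟨h1, h2, h3, h4⟩, h5, h6, h7, h8⟩ ⟨s', t'⟩
      ⟨⟨h1', h2', h3', h4'⟩, h5', h6', h7', h8'⟩ a b ha hb hab
    simp only at *
    obtain rfl : a = 1 - b := by linarith
    simp only [Prod.smul_mk, Prod.mk_add_mk, smul_eq_mul, hK₄, Set.mem_ofPred_eq, Tri]
    refine ⟨⟨?_, ?_, ?_, ?_⟩, ?_, ?_, ?_, ?_⟩ <;> nlinarith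
  have p₃ : IsPreconnected K₃ := by
    refine isPreconnected_of_fibers c₃ f₃ (i₃ ▸ p₄) fun ⟨x, t⟩ => ?_
    by_cases h : Tri t x y
    · convert isPreconnected_circle U x t using 1
      ext d
      constructor
      · rintro ⟨-, heq⟩
        exact Prod.mk.inj heq
      · rintro ⟨rfl, rfl⟩
        exact ⟨h, rfl⟩
    · convert isPreconnected_empty
      rw [Set.eq_empty_iff_forall_notMem]
      rintro d ⟨hd, heq⟩
      obtain ⟨rfl, rfl⟩ := Prod.mk.inj heq
      exact h hd
  have p₂ : IsPreconnected K₂ := by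
    refine isPreconnected_of_fibers c₂ continuous_fst (i₂ ▸ p₃) fun d => ?_
    convert (isPreconnected_circle (U * d) (phi d) y).image (fun e => (d, e))
      (by fun_prop) using 1
    ext ⟨d', e⟩
    constructor
    · rintro ⟨h, rfl⟩
      exact ⟨e, h, rfl⟩
    · rintro ⟨e, h, heq⟩
      obtain ⟨rfl, rfl⟩ := Prod.mk.inj heq
      exact ⟨h, rfl⟩
  refine isPreconnected_of_fibers c₁ f₁ (i₁ ▸ p₂) fun ⟨d, e⟩ => ?_
  by_cases h : phi (U * d * e) = y
  · convert (isPreconnected_intertwiner d⁻¹ e).image (fun c => (c, d)) (by fun_prop) using 1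
    ext ⟨c, d'⟩
    constructor
    · rintro ⟨-, heq⟩
      obtain ⟨rfl, rfl⟩ := Prod.mk.inj heq
      exact ⟨c, by simp, rfl⟩
    · rintro ⟨c, hc, heq⟩
      obtain ⟨rfl, rfl⟩ := Prod.mk.inj heq
      have hc : c * d⁻¹ = e * c := hc
      have hc' : c * d⁻¹ * c⁻¹ = e := by rw [hc]; group
      refine ⟨?_, ?_⟩
      · change phi (U * d * (c * d⁻¹ * c⁻¹)) = y
        rw [hc', h]
      · change (d, c * d⁻¹ * c⁻¹) = (d, e)
        rw [hc']
  · convert isPreconnected_empty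
    rw [Set.eq_empty_iff_forall_notMem]
    rintro ⟨c, d'⟩ ⟨hd, heq⟩
    obtain ⟨rfl, rfl⟩ := Prod.mk.inj heq
    exact h hd

lemma continuous_prod_comm {X : Type*} [TopologicalSpace X] {g : ℕ} {c d : Fin g → X → SU2}
    (hc : ∀ i, Continuous (c i)) (hd : ∀ i, Continuous (d i)) :
    Continuous fun x => (List.ofFn fun i => comm (c i x) (d i x)).prod :=
  continuous_prod_ofFn fun i =>
    (((hc i).mul (hd i)).mul (hc i).inv).mul (hd i).inv

lemma ConnectedLevels.prod_comm {X : Type*} [TopologicalSpace X] [T2Space X] {K : Set X}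
    {f : X → SU2} (hf : ConnectedLevels K f) (g : ℕ) :
    ConnectedLevels (K ×ˢ (Set.univ : Set (Fin g → SU2 × SU2)))
      (fun v => (List.ofFn fun i => comm (v.2 i).1 (v.2 i).2).prod⁻¹ * f v.1) := by
  have hcf := hf.continuous
  have hcont (g : ℕ) : Continuous fun v : X × (Fin g → SU2 × SU2) =>
      (List.ofFn fun i => comm (v.2 i).1 (v.2 i).2).prod⁻¹ * f v.1 :=
    (continuous_prod_comm (c := fun i (v : X × (Fin g → SU2 × SU2)) => (v.2 i).1)
      (d := fun i (v : X × (Fin g → SU2 × SU2)) => (v.2 i).2)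
      (fun i => by fun_prop) fun i => by fun_prop).inv.mul (by fun_prop)
  induction g with
  | zero =>
    refine hf.image (e := fun x => (x, Fin.elim0)) (by fun_prop) (hcont 0) (fun x => by simp) ?_
    ext ⟨x, v⟩
    constructor
    · rintro ⟨x, hx, heq⟩
      obtain ⟨rfl, -⟩ := Prod.mk.inj heq
      exact ⟨hx, trivial⟩
    · rintro ⟨hx, -⟩
      exact ⟨x, hx, Prod.ext rfl (Subsingleton.elim _ _)⟩
  | succ g ih =>
    -- One commutator reaches every phase from every `U`, so there is no constraint between old and
    -- new phase.
    have hR : Convex ℝ ((Set.univ : Set ℝ) ×ˢ Set.Icc (0 : ℝ) (1 / 2)) :=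
      convex_univ.prod (convex_Icc _ _)
    have h := ih.prod (L := (Set.univ : Set (SU2 × SU2)))
      (h := fun U v => (comm v.1 v.2)⁻¹ * U) isCompact_univ
      (by unfold comm; fun_prop) hR (fun U t => by
        simpa using isPreconnected_comm_level U t) (fun U t => by
        constructor
        · rintro ⟨a, -, rfl⟩
          exact ⟨trivial, phi_mem _⟩
        · rintro ⟨-, ht⟩
          obtain ⟨c, d, hcd⟩ := exists_phi_comm_inv_mul U ht
          exact ⟨(c, d), trivial, hcd⟩)
    refine h.image (e := fun v => (v.1.1, (Fin.snoc v.1.2 v.2 : Fin (g + 1) → SU2 × SU2)))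
      (by fun_prop) (hcont _) (fun v => ?_) ?_
    · rw [prod_ofFn_snoc]; simp [mul_assoc]
    · ext ⟨x, v⟩
      constructor
      · rintro ⟨v, ⟨⟨h1, -⟩, -⟩, heq⟩
        obtain ⟨rfl, -⟩ := Prod.mk.inj heq
        exact ⟨h1, trivial⟩
      · rintro ⟨hx, -⟩
        exact ⟨((x, Fin.init v), v (Fin.last g)), ⟨⟨hx, trivial⟩, trivial⟩,
          Prod.ext rfl (Fin.snoc_init_self v)⟩

/-- The holonomies on the generators `a`, `c`, `d` of flat connections, with prescribed phases of
the `a j`, form a connected set. -/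
lemma isPreconnected_holonomies {n : ℕ} (g : ℕ) (θ : Fin n → ℝ) :
    IsPreconnected {v : (Fin n → SU2) × (Fin g → SU2 × SU2) | (∀ j, phi (v.1 j) = θ j) ∧
      (List.ofFn v.1).prod = (List.ofFn fun i => comm (v.2 i).1 (v.2 i).2).prod} := by
  -- Phase `0` characterises the identity, so the product relation is itself a level set.
  convert ((connectedLevels_classes θ).prod_comm g).fiber 0 using 1
  ext v
  simp only [Set.mem_ofPred_eq, Set.mem_prod, Set.mem_univ, and_true]
  rw [phi_eq_zero_iff, inv_mul_eq_one, eq_comm (a := (List.ofFn v.1).prod)]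

/-! ### The quantum polygon inequalities -/

/-- The `ℓ¹`-distances from a point of the cube `[0, 1/2]ⁿ` to the sets of even and of odd
vertices, the second one truncated at `1/2` for `n = 0`. -/
def cubeDist : {n : ℕ} → (Fin n → ℝ) → ℝ × ℝ
  | 0, _ => (0, 1 / 2)
  | _ + 1, θ =>
    (min ((cubeDist (Fin.init θ)).1 + θ (Fin.last _))
        ((cubeDist (Fin.init θ)).2 + (1 / 2 - θ (Fin.last _))),
      min ((cubeDist (Fin.init θ)).2 + θ (Fin.last _))
        ((cubeDist (Fin.init θ)).1 + (1 / 2 - θ (Fin.last _))))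

/-- The distance to the even vertices. -/
def evenDist {n : ℕ} (θ : Fin n → ℝ) : ℝ := (cubeDist θ).1

/-- The distance to the odd vertices. -/
def oddDist {n : ℕ} (θ : Fin n → ℝ) : ℝ := (cubeDist θ).2

lemma evenDist_zero (θ : Fin 0 → ℝ) : evenDist θ = 0 := rfl
lemma oddDist_zero (θ : Fin 0 → ℝ) : oddDist θ = 1 / 2 := rfl

lemma evenDist_succ {n : ℕ} (θ : Fin (n + 1) → ℝ) : evenDist θ =
    min (evenDist (Fin.init θ : Fin n → ℝ) + θ (Fin.last n))
      (oddDist (Fin.init θ : Fin n → ℝ) + (1 / 2 - θ (Fin.last n))) := rfl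

lemma oddDist_succ {n : ℕ} (θ : Fin (n + 1) → ℝ) : oddDist θ =
    min (oddDist (Fin.init θ : Fin n → ℝ) + θ (Fin.last n))
      (evenDist (Fin.init θ : Fin n → ℝ) + (1 / 2 - θ (Fin.last n))) := rfl

/-- The last bound holds because an even and an odd vertex are at distance at least `1/2`. It makes
the interval from `1/2 - oddDist θ` to `evenDist θ` nonempty. -/
lemma dist_bounds {n : ℕ} {θ : Fin n → ℝ} (h : ∀ j, θ j ∈ Set.Icc (0 : ℝ) (1 / 2)) :
    0 ≤ evenDist θ ∧ 0 ≤ oddDist θ ∧ 1 / 2 ≤ evenDist θ + oddDist θ := by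
  induction n with
  | zero => rw [evenDist_zero, oddDist_zero]; norm_num
  | succ n ih =>
    obtain ⟨h1, h2, h3⟩ := ih (θ := Fin.init θ) fun j => h j.castSucc
    obtain ⟨hx, hx'⟩ := h (Fin.last n)
    rw [evenDist_succ, oddDist_succ]
    refine ⟨le_min ?_ ?_, le_min ?_ ?_, ?_⟩
    · linarith
    · linarith
    · linarith
    · linarith
    · rcases min_choice (evenDist (Fin.init θ : Fin n → ℝ) + θ (Fin.last n))
        (oddDist (Fin.init θ : Fin n → ℝ) + (1 / 2 - θ (Fin.last n))) with h4 | h4 <;>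
      rcases min_choice (oddDist (Fin.init θ : Fin n → ℝ) + θ (Fin.last n))
        (evenDist (Fin.init θ : Fin n → ℝ) + (1 / 2 - θ (Fin.last n))) with h5 | h5 <;>
      rw [h4, h5] <;> linarith

/-- Changing one coordinate of a vertex flips its parity and moves it by `1/2`; for `n = 0` the
truncation value is just right. -/
lemma oddDist_le {n : ℕ} {θ : Fin n → ℝ} (h : ∀ j, θ j ∈ Set.Icc (0 : ℝ) (1 / 2)) :
    oddDist θ ≤ evenDist θ + 1 / 2 := by
  cases n with
  | zero => rw [evenDist_zero, oddDist_zero]; norm_num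
  | succ n =>
    obtain ⟨hx, hx'⟩ := h (Fin.last n)
    rw [evenDist_succ, oddDist_succ, ← min_add_add_right]
    exact le_min ((min_le_right _ _).trans (by linarith)) ((min_le_left _ _).trans (by linarith))

lemma vertex_of_dist_eq_zero {n : ℕ} {θ : Fin n → ℝ} (h : ∀ j, θ j ∈ Set.Icc (0 : ℝ) (1 / 2)) :
    (evenDist θ = 0 → (∀ j, θ j = 0 ∨ θ j = 1 / 2) ∧ ∃ k : ℤ, ∑ j, θ j = k) ∧
    (oddDist θ = 0 → (∀ j, θ j = 0 ∨ θ j = 1 / 2) ∧ ∃ k : ℤ, ∑ j, θ j = k - 1 / 2) := by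
  induction n with
  | zero =>
    refine ⟨fun _ => ⟨fun j => j.elim0, 0, by simp⟩, fun h => ?_⟩
    rw [oddDist_zero] at h; norm_num at h
  | succ n ih =>
    obtain ⟨h1, h2, -⟩ := dist_bounds (θ := Fin.init θ) fun j => h j.castSucc
    obtain ⟨ihE, ihO⟩ := ih (θ := Fin.init θ) fun j => h j.castSucc
    obtain ⟨hx, hx'⟩ := h (Fin.last n)
    have hall (hi : ∀ j : Fin n, (Fin.init θ : Fin n → ℝ) j = 0 ∨
        (Fin.init θ : Fin n → ℝ) j = 1 / 2)
        (hl : θ (Fin.last n) = 0 ∨ θ (Fin.last n) = 1 / 2) : ∀ j, θ j = 0 ∨ θ j = 1 / 2 :=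
      fun j => Fin.lastCases hl hi j
    rw [evenDist_succ, oddDist_succ, Fin.sum_univ_castSucc]
    constructor
    · intro h0
      rcases min_choice (evenDist (Fin.init θ : Fin n → ℝ) + θ (Fin.last n))
        (oddDist (Fin.init θ : Fin n → ℝ) + (1 / 2 - θ (Fin.last n))) with h4 | h4 <;>
        rw [h4] at h0
      · obtain ⟨hi, k, hk⟩ := ihE (by linarith)
        refine ⟨hall hi (Or.inl (by linarith)), k, ?_⟩
        simp only [Fin.init] at hk; linarith
      · obtain ⟨hi, k, hk⟩ := ihO (by linarith)
        refine ⟨hall hi (Or.inr (by linarith)), k, ?_⟩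
        simp only [Fin.init] at hk; linarith
    · intro h0
      rcases min_choice (oddDist (Fin.init θ : Fin n → ℝ) + θ (Fin.last n))
        (evenDist (Fin.init θ : Fin n → ℝ) + (1 / 2 - θ (Fin.last n))) with h5 | h5 <;>
        rw [h5] at h0
      · obtain ⟨hi, k, hk⟩ := ihO (by linarith)
        refine ⟨hall hi (Or.inl (by linarith)), k, ?_⟩
        simp only [Fin.init] at hk; linarith
      · obtain ⟨hi, k, hk⟩ := ihE (by linarith)
        refine ⟨hall hi (Or.inr (by linarith)), k + 1, ?_⟩
        simp only [Fin.init] at hk; push_cast; linarith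

lemma dist_pos {n : ℕ} {θ : Fin n → ℝ} (h : ∀ j, θ j ∈ Set.Icc (0 : ℝ) (1 / 2)) {j : Fin n}
    (hj : ¬ (θ j = 0 ∨ θ j = 1 / 2)) : 0 < evenDist θ ∧ 0 < oddDist θ := by
  obtain ⟨h1, h2, -⟩ := dist_bounds h
  obtain ⟨h3, h4⟩ := vertex_of_dist_eq_zero h
  exact ⟨lt_of_le_of_ne h1 fun h0 => hj ((h3 h0.symm).1 j),
    lt_of_le_of_ne h2 fun h0 => hj ((h4 h0.symm).1 j)⟩

/-- The distance from `θ` to the vertex `v` of the cube. -/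
def vertexDist {n : ℕ} (θ : Fin n → ℝ) (v : Fin n → Bool) : ℝ :=
  ∑ j, if v j then 1 / 2 - θ j else θ j

/-- The number of nonzero coordinates of a vertex. -/
def vertexWeight {n : ℕ} (v : Fin n → Bool) : ℕ := ∑ j, if v j then 1 else 0

lemma vertexDist_snoc {n : ℕ} (θ : Fin (n + 1) → ℝ) (v : Fin (n + 1) → Bool) :
    vertexDist θ v = vertexDist (Fin.init θ : Fin n → ℝ) (Fin.init v : Fin n → Bool) +
      if v (Fin.last n) then 1 / 2 - θ (Fin.last n) else θ (Fin.last n) :=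
  Fin.sum_univ_castSucc _

lemma vertexWeight_snoc {n : ℕ} (v : Fin (n + 1) → Bool) :
    vertexWeight v = vertexWeight (Fin.init v : Fin n → Bool) +
      if v (Fin.last n) then 1 else 0 :=
  Fin.sum_univ_castSucc _

lemma dist_le_vertexDist {n : ℕ} (θ : Fin n → ℝ) (v : Fin n → Bool) :
    (Even (vertexWeight v) → evenDist θ ≤ vertexDist θ v) ∧
      (Odd (vertexWeight v) → oddDist θ ≤ vertexDist θ v) := by
  induction n with
  | zero => simp [vertexWeight, vertexDist, evenDist_zero]
  | succ n ih =>
    obtain ⟨ihE, ihO⟩ := ih (Fin.init θ) (Fin.init v)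
    rw [vertexWeight_snoc, vertexDist_snoc, evenDist_succ, oddDist_succ]
    cases hv : v (Fin.last n) <;> simp only [Bool.false_eq_true, if_false, if_true, add_zero]
    · exact ⟨fun h => (min_le_left _ _).trans (by linarith [ihE h]),
        fun h => (min_le_left _ _).trans (by linarith [ihO h])⟩
    · rw [Nat.even_add_one, Nat.odd_add_one, Nat.not_even_iff_odd, Nat.not_odd_iff_even]
      exact ⟨fun h => (min_le_right _ _).trans (by linarith [ihO h]),
        fun h => (min_le_right _ _).trans (by linarith [ihE h])⟩

/-- With `dist_le_vertexDist` this shows that the recursion computes the minimal distances. The odd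
half needs `0 < n`, since the point has no odd vertex. -/
lemma exists_vertexDist_le {n : ℕ} {θ : Fin n → ℝ} (h : ∀ j, θ j ∈ Set.Icc (0 : ℝ) (1 / 2)) :
    (∃ v, Even (vertexWeight v) ∧ vertexDist θ v ≤ evenDist θ) ∧
      (0 < n → ∃ v, Odd (vertexWeight v) ∧ vertexDist θ v ≤ oddDist θ) := by
  induction n with
  | zero => exact ⟨⟨fun _ => false, by simp [vertexWeight, vertexDist, evenDist_zero]⟩, by simp⟩
  | succ n ih =>
    obtain ⟨⟨v, hv, hv'⟩, ihO⟩ := ih (θ := Fin.init θ) fun j => h j.castSucc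
    obtain ⟨hx, hx'⟩ := h (Fin.last n)
    have key (w : Fin n → Bool) (b : Bool) :
        vertexDist θ (Fin.snoc w b : Fin (n + 1) → Bool) =
          vertexDist (Fin.init θ : Fin n → ℝ) w +
            (if b then 1 / 2 - θ (Fin.last n) else θ (Fin.last n)) ∧
        vertexWeight (Fin.snoc w b : Fin (n + 1) → Bool) =
          vertexWeight w + if b then 1 else 0 := by
      rw [vertexDist_snoc, vertexWeight_snoc]; simp
    have e0 := key v false
    have e1 := key v true
    simp only [Bool.false_eq_true, if_false, if_true, add_zero] at e0 e1
    rw [evenDist_succ, oddDist_succ]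
    have ev : Even (vertexWeight (Fin.snoc v false : Fin (n + 1) → Bool)) := e0.2 ▸ hv
    have od : Odd (vertexWeight (Fin.snoc v true : Fin (n + 1) → Bool)) :=
      e1.2 ▸ hv.add_one
    rcases Nat.eq_zero_or_pos n with rfl | hn
    · rw [evenDist_zero, oddDist_zero] at *
      refine ⟨⟨_, ev, ?_⟩, fun _ => ⟨_, od, ?_⟩⟩
      · rw [e0.1]; apply le_min <;> linarith
      · rw [e1.1]; apply le_min <;> linarith
    · obtain ⟨w, hw, hw'⟩ := ihO hn
      have o0 := key w false
      have o1 := key w true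
      simp only [Bool.false_eq_true, if_false, if_true, add_zero] at o0 o1
      have ev' : Even (vertexWeight (Fin.snoc w true : Fin (n + 1) → Bool)) :=
        o1.2 ▸ hw.add_one
      have od' : Odd (vertexWeight (Fin.snoc w false : Fin (n + 1) → Bool)) := o0.2 ▸ hw
      refine ⟨?_, fun _ => ?_⟩
      · rcases min_choice (evenDist (Fin.init θ : Fin n → ℝ) + θ (Fin.last n))
          (oddDist (Fin.init θ : Fin n → ℝ) + (1 / 2 - θ (Fin.last n))) with h4 | h4 <;> rw [h4]
        · exact ⟨_, ev, by rw [e0.1]; linarith⟩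
        · exact ⟨_, ev', by rw [o1.1]; linarith⟩
      · rcases min_choice (oddDist (Fin.init θ : Fin n → ℝ) + θ (Fin.last n))
          (evenDist (Fin.init θ : Fin n → ℝ) + (1 / 2 - θ (Fin.last n))) with h4 | h4 <;> rw [h4]
        · exact ⟨_, od', by rw [o0.1]; linarith⟩
        · exact ⟨_, od, by rw [e1.1]; linarith⟩

lemma vertexDist_eq {n : ℕ} (θ : Fin n → ℝ) (v : Fin n → Bool) :
    vertexDist θ v = ((Finset.univ.filter fun j => v j).card : ℝ) / 2 -
      (∑ j ∈ Finset.univ.filter fun j => v j, θ j -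
        ∑ j ∈ (Finset.univ.filter fun j => v j)ᶜ, θ j) := by
  unfold vertexDist
  rw [← Finset.sum_add_sum_compl (Finset.univ.filter fun j => v j)]
  have h1 : ∑ j ∈ Finset.univ.filter (fun j => v j), (if v j then 1 / 2 - θ j else θ j) =
      ∑ j ∈ Finset.univ.filter (fun j => v j), (1 / 2 - θ j) :=
    Finset.sum_congr rfl fun j hj => if_pos (Finset.mem_filter.1 hj).2
  have h2 : ∑ j ∈ (Finset.univ.filter (fun j => v j))ᶜ, (if v j then 1 / 2 - θ j else θ j) =
      ∑ j ∈ (Finset.univ.filter (fun j => v j))ᶜ, θ j :=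
    Finset.sum_congr rfl fun j hj => if_neg (by simpa using hj)
  rw [h1, h2, Finset.sum_sub_distrib, Finset.sum_const, nsmul_eq_mul]
  ring

lemma vertexWeight_eq {n : ℕ} (v : Fin n → Bool) :
    vertexWeight v = (Finset.univ.filter fun j => v j).card := by
  unfold vertexWeight
  rw [Finset.card_filter]

/-- The inequality for `S` says that the vertex supported on `S` is at distance more than `1/2`, by
`vertexDist_eq`. -/
lemma quantumPolygon_iff {n : ℕ} {θ : Fin n → ℝ} (h : ∀ j, θ j ∈ Set.Icc (0 : ℝ) (1 / 2)) :
    QuantumPolygon θ ↔ 1 / 2 < oddDist θ := by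
  constructor
  · rintro ⟨hn, hS⟩
    obtain ⟨v, hv, hv'⟩ := (exists_vertexDist_le h).2 hn
    rw [vertexWeight_eq] at hv
    have := hS _ hv
    rw [vertexDist_eq] at hv'
    linarith
  · intro hO
    refine ⟨Nat.pos_of_ne_zero ?_, fun S hS => ?_⟩
    · rintro rfl
      rw [oddDist_zero] at hO
      exact lt_irrefl _ hO
    · have hv : (Finset.univ.filter fun j => (decide (j ∈ S) : Bool) = true) = S := by
        ext j; simp
      have := (dist_le_vertexDist θ fun j => decide (j ∈ S)).2
        (by rw [vertexWeight_eq, hv]; exact hS)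
      rw [vertexDist_eq, hv] at this
      linarith

/-! ### Phases of products -/

lemma exists_prod_phi_eq {n : ℕ} {θ : Fin n → ℝ} (h : ∀ j, θ j ∈ Set.Icc (0 : ℝ) (1 / 2))
    {y : ℝ} (hy : y ∈ Set.Icc (0 : ℝ) (1 / 2)) (hO : 1 / 2 - oddDist θ ≤ y)
    (hE : y ≤ evenDist θ) :
    ∃ a : Fin n → SU2, (∀ j, phi (a j) = θ j) ∧ phi (List.ofFn a).prod = y := by
  induction n generalizing y with
  | zero =>
    rw [evenDist_zero] at hE
    refine ⟨Fin.elim0, fun j => j.elim0, ?_⟩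
    rw [le_antisymm hE hy.1, phi_eq_zero_iff]; simp
  | succ n ih =>
    obtain ⟨h1, h2, h3⟩ := dist_bounds (θ := Fin.init θ) fun j => h j.castSucc
    obtain ⟨hx, hx'⟩ := h (Fin.last n)
    rw [evenDist_succ, le_min_iff] at hE
    rw [oddDist_succ, sub_le_iff_le_add, ← sub_le_iff_le_add', le_min_iff] at hO
    obtain ⟨hE1, hE2⟩ := hE
    obtain ⟨hO1, hO2⟩ := hO
    set x := θ (Fin.last n)
    -- The phase chosen for the product of all but the last factor: the least value allowed by the
    -- lower bounds. The hypotheses on `y` say that every lower bound is at most every upper bound.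
    set t := max (1 / 2 - oddDist (Fin.init θ : Fin n → ℝ)) (max (x - y) (y - x)) with ht
    have t1 : 1 / 2 - oddDist (Fin.init θ : Fin n → ℝ) ≤ t := le_max_left _ _
    have t2 : x - y ≤ t := (le_max_left _ _).trans (le_max_right _ _)
    have t3 : y - x ≤ t := (le_max_right _ _).trans (le_max_right _ _)
    have t4 {s : ℝ} (s1 : 1 / 2 - oddDist (Fin.init θ : Fin n → ℝ) ≤ s) (s2 : x - y ≤ s)
      (s3 : y - x ≤ s) : t ≤ s := max_le s1 (max_le s2 s3)
    obtain ⟨hy0, hy1⟩ := hy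
    have htri : Tri t x y := by
      refine ⟨?_, ?_, ?_, ?_⟩
      · linarith [t4 (s := x + y) (by linarith) (by linarith) (by linarith)]
      · linarith
      · linarith
      · linarith [t4 (s := 1 - x - y) (by linarith) (by linarith) (by linarith)]
    obtain ⟨a, ha, ha'⟩ := ih (θ := Fin.init θ) (fun j => h j.castSucc) htri.mem.1 t1
      (t4 (by linarith) (by linarith) (by linarith))
    obtain ⟨b, hb, hb'⟩ := exists_of_tri (ha'.symm ▸ htri)
    refine ⟨Fin.snoc a b, fun j => ?_, ?_⟩
    · refine Fin.lastCases ?_ (fun j => ?_) j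
      · simpa using hb
      · rw [Fin.snoc_castSucc]; exact ha j
    · rw [prod_ofFn_snoc]; simpa using hb'

lemma exists_not_commute_of_prod {n : ℕ} {a : Fin n → SU2} {b : SU2}
    (h : (List.ofFn a).prod * b ≠ b * (List.ofFn a).prod) : ∃ j, a j * b ≠ b * a j := by
  by_contra hc
  push Not at hc
  refine h (Commute.list_prod_left _ _ fun x hx => ?_)
  obtain ⟨j, rfl⟩ := (List.mem_ofFn' _ _).1 hx
  exact hc j

/-- If the initial product has room to vary (`α < β`), its phase can be taken strictly inside its
range and the non-commuting pair comes from the induction. If its phase is forced to be `β`, the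
triangle with the last factor is strict, so that factor supplies the pair. -/
lemma exists_prod_phi_eq_not_commute {n : ℕ} {θ : Fin n → ℝ}
    (h : ∀ j, θ j ∈ Set.Icc (0 : ℝ) (1 / 2))
    {y : ℝ} (hy : y ∈ Set.Icc (0 : ℝ) (1 / 2)) (hO : 1 / 2 - oddDist θ < y)
    (hE : y < evenDist θ) :
    ∃ a : Fin n → SU2, (∀ j, phi (a j) = θ j) ∧ phi (List.ofFn a).prod = y ∧
      ∃ i j, a i * a j ≠ a j * a i := by
  induction n generalizing y with
  | zero =>
    rw [evenDist_zero] at hE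
    exact absurd hy.1 (not_le.2 hE)
  | succ n ih =>
    obtain ⟨h1, h2, h3⟩ := dist_bounds (θ := Fin.init θ) fun j => h j.castSucc
    obtain ⟨hx, hx'⟩ := h (Fin.last n)
    rw [evenDist_succ, lt_min_iff] at hE
    rw [oddDist_succ, sub_lt_iff_lt_add, ← sub_lt_iff_lt_add', lt_min_iff] at hO
    obtain ⟨hE1, hE2⟩ := hE
    obtain ⟨hO1, hO2⟩ := hO
    have hext (a : Fin n → SU2) (b : SU2) (ha : ∀ j, phi (a j) = θ j.castSucc)
        (hb : phi b = θ (Fin.last n)) :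
        ∀ j, phi ((Fin.snoc a b : Fin (n + 1) → SU2) j) = θ j := by
      refine fun j => Fin.lastCases ?_ (fun j => ?_) j
      · simpa using hb
      · simpa using ha j
    set x := θ (Fin.last n)
    set α := 1 / 2 - oddDist (Fin.init θ : Fin n → ℝ) with hα
    set β := evenDist (Fin.init θ : Fin n → ℝ) with hβ
    obtain ⟨hy0, hy1⟩ := hy
    rcases lt_or_ge α β with hαβ | hαβ
    · set l := max α (max (x - y) (y - x)) with hl
      set u := min β (min (x + y) (1 - x - y)) with hu
      have l1 : α ≤ l := le_max_left _ _
      have l2 : x - y ≤ l := (le_max_left _ _).trans (le_max_right _ _)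
      have l3 : y - x ≤ l := (le_max_right _ _).trans (le_max_right _ _)
      have u1 : u ≤ β := min_le_left _ _
      have u2 : u ≤ x + y := (min_le_right _ _).trans (min_le_left _ _)
      have u3 : u ≤ 1 - x - y := (min_le_right _ _).trans (min_le_right _ _)
      have hαu : α < u := lt_min hαβ (lt_min (by linarith) (by linarith))
      have hlβ : l < β := max_lt hαβ (max_lt (by linarith) (by linarith))
      have hlu : l ≤ u := by
        refine max_le hαu.le (max_le ?_ ?_) <;> refine le_min ?_ (le_min ?_ ?_) <;> linarith
      -- The midpoint avoids both `α` and `β`, although `l` may equal `α` and `u` may equal `β`.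
      have htri : Tri ((l + u) / 2) x y := by
        refine ⟨?_, ?_, ?_, ?_⟩ <;> linarith
      obtain ⟨a, ha, ha', i, j, hij⟩ := ih (θ := Fin.init θ) (fun j => h j.castSucc) htri.mem.1
        (by linarith) (by linarith)
      obtain ⟨b, hb, hb'⟩ := exists_of_tri (ha'.symm ▸ htri)
      refine ⟨Fin.snoc a b, hext a b ha hb, ?_, i.castSucc, j.castSucc, by simpa using hij⟩
      rw [prod_ofFn_snoc]; simpa using hb'
    · have htri : StrictTri β x y := by
        refine ⟨?_, ?_, ?_, ?_⟩ <;> linarith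
      obtain ⟨a, ha, ha'⟩ := exists_prod_phi_eq (θ := Fin.init θ) (fun j => h j.castSucc)
        htri.tri.mem.1 (by linarith) le_rfl
      obtain ⟨b, hb, hb'⟩ := exists_of_tri (ha'.symm ▸ htri.tri)
      have hs : (List.ofFn a).prod * b ≠ b * (List.ofFn a).prod := by
        rw [← strictTri_mul_iff, ha', hb, hb']; exact htri
      obtain ⟨j, hj⟩ := exists_not_commute_of_prod hs
      refine ⟨Fin.snoc a b, hext a b ha hb, ?_, j.castSucc, Fin.last n, by simpa using hj⟩
      rw [prod_ofFn_snoc]; simpa using hb'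

/-- The polygon inequalities for the phase of a product, strict in the non-abelian case. -/
lemma phi_prod_bounds {n : ℕ} (a : Fin n → SU2) :
    (1 / 2 - oddDist (fun j => phi (a j)) ≤ phi (List.ofFn a).prod ∧
      phi (List.ofFn a).prod ≤ evenDist (fun j => phi (a j))) ∧
    ((∃ i j, a i * a j ≠ a j * a i) →
      1 / 2 - oddDist (fun j => phi (a j)) < phi (List.ofFn a).prod ∧
      phi (List.ofFn a).prod < evenDist (fun j => phi (a j))) := by
  induction n with
  | zero =>
    have : phi (List.ofFn a).prod = 0 := by rw [phi_eq_zero_iff]; simp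
    rw [evenDist_zero, oddDist_zero, this]
    exact ⟨by norm_num, fun ⟨i, _⟩ => i.elim0⟩
  | succ n ih =>
    have hth (j : Fin n) : phi (a j.castSucc) ∈ Set.Icc (0 : ℝ) (1 / 2) := phi_mem _
    obtain ⟨h1, h2, h3⟩ := dist_bounds hth
    have ih := ih fun j => a j.castSucc
    have hE := evenDist_succ fun j => phi (a j)
    have hO := oddDist_succ fun j => phi (a j)
    have hinit : (Fin.init fun j => phi (a j) : Fin n → ℝ) = fun j => phi (a j.castSucc) := rfl
    rw [hinit] at hE hO
    rw [hE, hO, prod_ofFn_snoc, sub_le_iff_le_add, sub_lt_iff_lt_add, ← sub_le_iff_le_add',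
      ← sub_lt_iff_lt_add', le_min_iff, le_min_iff, lt_min_iff, lt_min_iff]
    set U := (List.ofFn fun j : Fin n => a j.castSucc).prod with hU
    have htri := tri_mul U (a (Fin.last n))
    have hst := strictTri_mul_iff U (a (Fin.last n))
    have hx := phi_mem (a (Fin.last n))
    set b := a (Fin.last n) with hb
    set y := phi (U * b)
    obtain ⟨⟨b1, b2⟩, b3⟩ := ih
    obtain ⟨t1, t2, t3, t4⟩ := htri
    refine ⟨⟨⟨by linarith, by linarith⟩, by linarith, by linarith⟩, fun hne => ?_⟩
    by_cases hi : ∃ i j : Fin n, a i.castSucc * a j.castSucc ≠ a j.castSucc * a i.castSucc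
    · obtain ⟨c1, c2⟩ := b3 hi
      exact ⟨⟨by linarith, by linarith⟩, by linarith, by linarith⟩
    · push Not at hi
      obtain ⟨j, hj⟩ : ∃ j : Fin n, a j.castSucc * b ≠ b * a j.castSucc := by
        by_contra hc
        push Not at hc
        obtain ⟨i, j, hij⟩ := hne
        apply hij
        refine Fin.lastCases ?_ (fun i => ?_) i <;> refine Fin.lastCases ?_ (fun j => ?_) j
        · rfl
        · exact (hc j).symm
        · exact hc i
        · exact hi i j
      -- The initial factors commute with each other, but one of them, `a_j`, does not commute with
      -- `b`. If `U` is central, strictness comes from the non-central `a_j`, which keeps the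
      -- initial phases away from the vertices. Otherwise `U` commutes with `a_j`, hence not with
      -- `b`, and the last triangle is strict.
      by_cases hc : phi U = 0 ∨ phi U = 1 / 2
      · have hbc : ¬ (phi b = 0 ∨ phi b = 1 / 2) := fun h => hj (commute_of_phi h _).symm
        have hac : ¬ (phi (a j.castSucc) = 0 ∨ phi (a j.castSucc) = 1 / 2) :=
          fun h => hj (commute_of_phi h _)
        obtain ⟨p1, p2⟩ := phi_pos_lt hbc
        obtain ⟨q1, q2⟩ := dist_pos hth hac
        rcases hc with hc | hc <;> rw [hc] at t1 t2 t3 t4 b1 b2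
        · exact ⟨⟨by linarith, by linarith⟩, by linarith, by linarith⟩
        · exact ⟨⟨by linarith, by linarith⟩, by linarith, by linarith⟩
      · have hUa : U * a j.castSucc = a j.castSucc * U :=
          Commute.list_prod_left _ _ fun x hx => by
            obtain ⟨i, rfl⟩ := (List.mem_ofFn' _ _).1 hx
            exact hi i j
        obtain ⟨s1, s2, s3, s4⟩ := hst.2 fun hUb => hj (commute_of_commute hc hUa hUb)
        exact ⟨⟨by linarith, by linarith⟩, by linarith, by linarith⟩

variable {g n : ℕ} {p q : Fin n → ℤ}

/-! ### Flat connections and their holonomies on the generators -/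

lemma comm_eq_one_iff {x y : SU2} : comm x y = 1 ↔ x * y = y * x := by
  unfold comm
  rw [mul_inv_eq_one, mul_inv_eq_iff_eq_mul]

lemma lift_relators_iff (f : Gen g n → SU2) :
    (∀ r ∈ relators g p q, FreeGroup.lift f r = 1) ↔
      (∀ j, f (.a j) ^ p j * f .b ^ q j = 1) ∧ (∀ y, f .b * f y = f y * f .b) ∧
      (List.ofFn fun j => f (.a j)).prod =
        (List.ofFn fun i => comm (f (.c i)) (f (.d i))).prod := by
  have hc (x y : Gen g n) : FreeGroup.lift f (comm (FreeGroup.of x) (FreeGroup.of y)) =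
      comm (f x) (f y) := by simp [comm]
  have hp : FreeGroup.lift f ((List.ofFn fun j : Fin n => FreeGroup.of (Gen.a j : Gen g n)).prod *
      ((List.ofFn fun i : Fin g =>
        comm (FreeGroup.of (Gen.c i : Gen g n)) (FreeGroup.of (Gen.d i))).prod)⁻¹) =
      (List.ofFn fun j => f (.a j)).prod *
        (List.ofFn fun i => comm (f (.c i)) (f (.d i))).prod⁻¹ := by
    rw [map_mul, map_inv, map_list_prod, map_list_prod, List.map_ofFn, List.map_ofFn]
    simp only [Function.comp_def, hc, FreeGroup.lift_apply_of]
  constructor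
  · intro h
    refine ⟨fun j => ?_, fun y => ?_, ?_⟩
    · simpa using h _ (Or.inl ⟨j, rfl⟩)
    · rw [← comm_eq_one_iff, ← hc]
      exact h _ (Or.inr (Or.inl ⟨y, rfl⟩))
    · rw [← mul_inv_eq_one, ← hp]
      exact h _ (Or.inr (Or.inr rfl))
  · rintro ⟨h1, h2, h3⟩ r (⟨j, rfl⟩ | ⟨y, rfl⟩ | rfl)
    · simpa using h1 j
    · rw [hc, comm_eq_one_iff]; exact h2 y
    · rw [hp, mul_inv_eq_one]; exact h3

/-- The flat connection with given holonomies on the generators. -/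
def mkHol (f : Gen g n → SU2) (hf : ∀ r ∈ relators g p q, FreeGroup.lift f r = 1) :
    Hol g p q :=
  PresentedGroup.toGroup hf

lemma mkHol_gen (f : Gen g n → SU2) (hf : ∀ r ∈ relators g p q, FreeGroup.lift f r = 1)
    (x : Gen g n) : mkHol f hf (gen g p q x) = f x :=
  PresentedGroup.toGroup.of hf

lemma hol_ext {ρ ρ' : Hol g p q} (h : ∀ x, ρ (gen g p q x) = ρ' (gen g p q x)) : ρ = ρ' :=
  PresentedGroup.ext h

lemma hol_relators (ρ : Hol g p q) :
    ∀ r ∈ relators g p q, FreeGroup.lift (fun x => ρ (gen g p q x)) r = 1 := by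
  intro r hr
  let σ : SeifertGroup g p q →* SU2 := ρ
  have h : FreeGroup.lift (fun x => ρ (gen g p q x)) =
      σ.comp (PresentedGroup.mk (relators g p q)) := by
    ext x; simp; rfl
  rw [h, MonoidHom.comp_apply, PresentedGroup.one_of_mem hr, map_one]

lemma hol_relations (ρ : Hol g p q) :
    (∀ j, ρ (gen g p q (.a j)) ^ p j * ρ (gen g p q .b) ^ q j = 1) ∧
    (∀ y, ρ (gen g p q .b) * ρ (gen g p q y) = ρ (gen g p q y) * ρ (gen g p q .b)) ∧
    (List.ofFn fun j => ρ (gen g p q (.a j))).prod =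
      (List.ofFn fun i => comm (ρ (gen g p q (.c i))) (ρ (gen g p q (.d i)))).prod :=
  (lift_relators_iff fun x => ρ (gen g p q x)).1 (hol_relators ρ)

lemma commute_hol {ρ : Hol g p q} {h : SU2}
    (hh : ∀ y, h * ρ (gen g p q y) = ρ (gen g p q y) * h) (x : SeifertGroup g p q) :
    h * ρ x = ρ x * h := by
  let σ : SeifertGroup g p q →* SU2 := ρ
  have := PresentedGroup.generated_by (relators g p q) ((Subgroup.centralizer {h}).comap σ)
    (fun y => by
      rw [Subgroup.mem_comap, Subgroup.mem_centralizer_singleton_iff]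
      exact (hh y).symm) x
  rw [Subgroup.mem_comap, Subgroup.mem_centralizer_singleton_iff] at this
  exact this.symm

lemma isIrreducible_of_not_commute {ρ : Hol g p q} {x y : SeifertGroup g p q}
    (h : ρ x * ρ y ≠ ρ y * ρ x) : IsIrreducible ρ := by
  intro k hk
  rw [mem_center_iff]
  by_contra hc
  exact h (commute_of_commute hc (hk x) (hk y))

/-- If all generators commuted, irreducibility would make their images central; then every element
of `SU(2)` would commute with all holonomies and so be central. -/
lemma exists_gen_not_commute {ρ : Hol g p q} (h : IsIrreducible ρ) :
    ∃ x y, ρ (gen g p q x) * ρ (gen g p q y) ≠ ρ (gen g p q y) * ρ (gen g p q x) := by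
  by_contra hc
  push Not at hc
  obtain ⟨U, V, hUV⟩ := exists_not_commute
  refine hUV ((Subgroup.mem_center_iff.1 (h V (commute_hol fun y => ?_))) U)
  exact Subgroup.mem_center_iff.1 (h _ (commute_hol (hc y))) V

lemma phi_b_of_isIrreducible {ρ : Hol g p q} (h : IsIrreducible ρ) :
    phi (ρ (gen g p q .b)) = 0 ∨ phi (ρ (gen g p q .b)) = 1 / 2 :=
  (mem_center_iff _).1 (h _ (commute_hol (hol_relations ρ).2.1))

/-- If `b` is non-central, all holonomies lie in its abelian centraliser, so the product of the
`a_j` is `1`. Raising it to the power `∏ p_i` and eliminating each `a_j` by its relation gives `b ^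
(-H) = 1`. -/
lemma phi_hol_rational (hp : ∀ j, p j ≠ 0) (hH : eulerH p q ≠ 0) (ρ : Hol g p q) :
    ∃ r : ℚ, phi (ρ (gen g p q .b)) = r := by
  obtain ⟨h1, h2, h3⟩ := hol_relations ρ
  set b := ρ (gen g p q .b)
  by_cases hb : phi b = 0 ∨ phi b = 1 / 2
  · rcases hb with h | h
    · exact ⟨0, by rw [h]; simp⟩
    · exact ⟨1 / 2, by rw [h]; norm_num⟩
  have hcom (x y : Gen g n) :
      ρ (gen g p q x) * ρ (gen g p q y) = ρ (gen g p q y) * ρ (gen g p q x) :=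
    commute_of_commute hb (h2 x) (h2 y)
  have h4 : (List.ofFn fun j => ρ (gen g p q (.a j))).prod = 1 := by
    rw [h3]
    refine List.prod_eq_one fun x hx => ?_
    obtain ⟨i, rfl⟩ := (List.mem_ofFn' _ _).1 hx
    exact comm_eq_one_iff.2 (hcom _ _)
  have hpow (j : Fin n) : ρ (gen g p q (.a j)) ^ (∏ i, p i) =
      b ^ (-(q j * ∏ i ∈ Finset.univ.erase j, p i)) := by
    rw [← Finset.mul_prod_erase _ _ (Finset.mem_univ j), zpow_mul, eq_inv_of_mul_eq_one_left (h1 j),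
      ← zpow_neg, ← zpow_mul, neg_mul]
  have hprod {m : ℕ} (a : Fin m → SU2) (e : Fin m → ℤ) (N : ℤ)
      (ha : ∀ i j, a i * a j = a j * a i) (hae : ∀ j, a j ^ N = b ^ e j) :
      (List.ofFn a).prod ^ N = b ^ ∑ j, e j := by
    induction m with
    | zero => simp
    | succ m ih =>
      have hc : Commute (a 0) (List.ofFn fun j : Fin m => a j.succ).prod :=
        Commute.list_prod_right _ _ fun x hx => by
          obtain ⟨i, rfl⟩ := (List.mem_ofFn' _ _).1 hx
          exact ha _ _
      rw [List.ofFn_succ, List.prod_cons, hc.mul_zpow, Fin.sum_univ_succ, zpow_add, hae,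
        ih _ (fun j => e j.succ) (fun i j => ha _ _) fun j => hae _]
  have h5 := hprod _ _ _ (fun i j => hcom (.a i) (.a j)) hpow
  rw [h4, one_zpow] at h5
  refine phi_rational_of_zpow_eq_one ?_ h5.symm
  intro h0
  apply hH
  have h6 : (eulerH p q) = ((∑ j, q j * ∏ i ∈ Finset.univ.erase j, p i : ℤ) : ℚ) := by
    unfold eulerH
    rw [Finset.mul_sum]
    push_cast
    refine Finset.sum_congr rfl fun j _ => ?_
    rw [← Finset.mul_prod_erase _ _ (Finset.mem_univ j)]
    have : (p j : ℚ) ≠ 0 := by exact_mod_cast hp j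
    field_simp
  rw [Finset.sum_neg_distrib, neg_eq_zero] at h0
  rw [h6, h0, Int.cast_zero]

/-! ### Phases on the moduli space -/

lemma continuous_hol_apply (x : SeifertGroup g p q) : Continuous fun ρ : Hol g p q => ρ x :=
  (continuous_apply x).comp continuous_induced_dom

/-- The phase of the holonomy of `x`, as a function on the moduli space. -/
def phiModuli (x : SeifertGroup g p q) : Moduli g p q → ℝ :=
  Quotient.lift (fun ρ : Hol g p q => phi (ρ x)) fun ρ ρ' ⟨h, hh⟩ => by
    rw [hh x, phi_conj']

lemma phiModuli_mk (x : SeifertGroup g p q) (ρ : Hol g p q) : phiModuli x ⟦ρ⟧ = phi (ρ x) := rfl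

lemma continuous_phiModuli (x : SeifertGroup g p q) : Continuous (phiModuli x) :=
  Continuous.quotient_lift (continuous_phi.comp (continuous_hol_apply x)) _

lemma mem_stratum_iff (i : (Fin n → ℤ) × Fin 2) (x : Moduli g p q) :
    x ∈ stratum g p q i ↔ phiModuli (gen g p q .b) x = (i.2.val : ℝ) / 2 ∧
      ∀ j, phiModuli (gen g p q (.a j)) x = phase p q i j := by
  constructor
  · rintro ⟨ρ, h1, h2, rfl⟩
    exact ⟨(hasPhase_iff _ _).1 h1, fun j => (hasPhase_iff _ _).1 (h2 j)⟩
  · induction x using Quotient.inductionOn with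
    | h ρ =>
      rintro ⟨h1, h2⟩
      exact ⟨ρ, (hasPhase_iff _ _).2 h1, fun j => (hasPhase_iff _ _).2 (h2 j), rfl⟩

lemma mem_centralLocus_iff (x : Moduli g p q) : x ∈ centralLocus g p q ↔
    phiModuli (gen g p q .b) x = 0 ∨ phiModuli (gen g p q .b) x = 1 / 2 := by
  constructor
  · rintro ⟨ρ, h, rfl⟩
    rwa [hasPhase_iff, hasPhase_iff] at h
  · induction x using Quotient.inductionOn with
    | h ρ =>
      intro h
      refine ⟨ρ, ?_, rfl⟩
      rwa [hasPhase_iff, hasPhase_iff]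

lemma fin_two_half (l : Fin 2) : (l.val : ℝ) / 2 = 0 ∨ (l.val : ℝ) / 2 = 1 / 2 := by
  fin_cases l <;> simp

lemma phi_eq_fin_two_half_iff (l : Fin 2) (U : SU2) :
    phi U = (l.val : ℝ) / 2 ↔ U = torusElement ((l.val : ℝ) / 2) := by
  rcases fin_two_half l with h | h <;> rw [h]
  · rw [torusElement_zero, phi_eq_zero_iff]
  · rw [phi_eq_half_iff]

lemma stratum_subset_centralLocus (i : (Fin n → ℤ) × Fin 2) :
    stratum g p q i ⊆ centralLocus g p q := fun x hx => by
  rw [mem_centralLocus_iff, ((mem_stratum_iff i x).1 hx).1]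
  exact fin_two_half i.2

lemma conj_zpow_mul_torusElement_eq_one_iff {a k : SU2} {θ : ℝ} (l : Fin 2) (P Q : ℤ)
    (ha : a = k * torusElement θ * k⁻¹) :
    a ^ P * torusElement ((l.val : ℝ) / 2) ^ Q = 1 ↔
      ∃ m : ℤ, P * θ + Q * ((l.val : ℝ) / 2) = m := by
  have hb : Commute (torusElement ((l.val : ℝ) / 2) ^ Q) k⁻¹ := by
    refine Commute.zpow_left ?_ _
    refine commute_of_phi ?_ _
    rw [(phi_eq_fin_two_half_iff l _).2 rfl]
    exact fin_two_half l
  rw [ha, conj_zpow, mul_assoc, ← hb.eq, ← mul_assoc, mul_assoc k, mul_inv_eq_one, mul_eq_left,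
    torusElement_zpow, torusElement_zpow, ← torusElement_add, torusElement_eq_one_iff]

lemma exists_mem_stratum (hp : ∀ j, p j ≠ 0) {x : Moduli g p q} (hx : x ∈ centralLocus g p q) :
    ∃ i, x ∈ stratum g p q i := by
  rw [mem_centralLocus_iff] at hx
  induction x using Quotient.inductionOn with
  | h ρ =>
    obtain ⟨l, hl⟩ : ∃ l : Fin 2, phi (ρ (gen g p q .b)) = (l.val : ℝ) / 2 := by
      rcases hx with h | h
      · exact ⟨0, by simpa [phiModuli_mk] using h⟩
      · exact ⟨1, by simpa [phiModuli_mk] using h⟩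
    have hm (j : Fin n) : ∃ m : ℤ, phi (ρ (gen g p q (.a j))) =
        ((m : ℝ) + (q j : ℝ) * ((l.val : ℝ) / 2)) / (p j : ℝ) := by
      have h := (hol_relations ρ).1 j
      obtain ⟨k, hk⟩ := exists_diagonalization (ρ (gen g p q (.a j)))
      rw [(phi_eq_fin_two_half_iff l _).1 hl, conj_zpow_mul_torusElement_eq_one_iff l _ _ hk] at h
      obtain ⟨m, hm⟩ := h
      -- The relation reads `p θ + q l / 2 = m`, whereas the index is normalised by `p θ = m' + q l
      -- / 2`.
      refine ⟨m - q j * l.val, ?_⟩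
      have : (p j : ℝ) ≠ 0 := by exact_mod_cast hp j
      rw [eq_div_iff this]
      push_cast
      linarith
    choose m hm using hm
    exact ⟨(m, l), (mem_stratum_iff _ _).2 ⟨hl, hm⟩⟩

lemma stratum_injective (hp : ∀ j, p j ≠ 0) {i i' : (Fin n → ℤ) × Fin 2} {x : Moduli g p q}
    (hi : x ∈ stratum g p q i) (hi' : x ∈ stratum g p q i') : i = i' := by
  rw [mem_stratum_iff] at hi hi'
  obtain ⟨m, l⟩ := i
  obtain ⟨m', l'⟩ := i'
  have hl : (l.val : ℝ) / 2 = (l'.val : ℝ) / 2 := hi.1.symm.trans hi'.1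
  have hl' : l = l' := by
    apply Fin.ext
    have : (l.val : ℝ) = l'.val := by linarith
    exact_mod_cast this
  subst hl'
  have hm : m = m' := by
    funext j
    have h := (hi.2 j).symm.trans (hi'.2 j)
    have : (p j : ℝ) ≠ 0 := by exact_mod_cast hp j
    unfold phase at h
    rw [div_left_inj' this, add_left_inj] at h
    exact_mod_cast h
  rw [hm]

lemma phase_rational (i : (Fin n → ℤ) × Fin 2) (j : Fin n) : ∃ r : ℚ, phase p q i j = r :=
  ⟨((i.1 j : ℚ) + (q j : ℚ) * ((i.2.val : ℚ) / 2)) / (p j : ℚ), by unfold phase; push_cast; rfl⟩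

/-- The rationals are countable, hence totally disconnected in the reals. -/
lemma eq_of_isPreconnected_of_rational {X : Type*} [TopologicalSpace X] {S : Set X}
    (hS : IsPreconnected S) {F : X → ℝ} (hF : Continuous F) (hr : ∀ x ∈ S, ∃ r : ℚ, F x = r)
    {x y : X} (hx : x ∈ S) (hy : y ∈ S) : F x = F y := by
  have hc : IsTotallyDisconnected (Set.range ((↑) : ℚ → ℝ)) :=
    (Set.countable_range _).isTotallyDisconnected
  refine hc (F '' S) ?_ (hS.image F hF.continuousOn) ⟨x, hx, rfl⟩ ⟨y, hy, rfl⟩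
  rintro _ ⟨z, hz, rfl⟩
  obtain ⟨r, hr⟩ := hr z hz
  exact ⟨r, hr.symm⟩

lemma component_subset_stratum (hp : ∀ j, p j ≠ 0) {i : (Fin n → ℤ) × Fin 2} {x : Moduli g p q}
    (hx : x ∈ stratum g p q i) :
    connectedComponentIn (centralLocus g p q) x ⊆ stratum g p q i := by
  intro y hy
  have hxc := mem_connectedComponentIn (stratum_subset_centralLocus i hx)
  have hsub := connectedComponentIn_subset (centralLocus g p q) x
  have hpre : IsPreconnected (connectedComponentIn (centralLocus g p q) x) :=
    isPreconnected_connectedComponentIn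
  rw [mem_stratum_iff] at hx ⊢
  refine ⟨?_, fun j => ?_⟩
  · rw [← hx.1]
    refine eq_of_isPreconnected_of_rational hpre (continuous_phiModuli _) (fun z hz => ?_) hy hxc
    rcases (mem_centralLocus_iff z).1 (hsub hz) with h | h
    · exact ⟨0, by rw [h]; simp⟩
    · exact ⟨1 / 2, by rw [h]; norm_num⟩
  · rw [← hx.2 j]
    refine eq_of_isPreconnected_of_rational hpre (continuous_phiModuli _) (fun z hz => ?_) hy hxc
    obtain ⟨i', hi'⟩ := exists_mem_stratum hp (hsub hz)
    rw [((mem_stratum_iff i' z).1 hi').2 j]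
    exact phase_rational i' j

lemma connectedComponent_eq (hp : ∀ j, p j ≠ 0) (hH : eulerH p q ≠ 0) {x : Moduli g p q}
    (hx : x ∈ centralLocus g p q) :
    connectedComponent x = connectedComponentIn (centralLocus g p q) x := by
  apply Set.Subset.antisymm
  · refine isPreconnected_connectedComponent.subset_connectedComponentIn mem_connectedComponent ?_
    intro y hy
    have : phiModuli (gen g p q .b) y = phiModuli (gen g p q .b) x :=
      eq_of_isPreconnected_of_rational isPreconnected_connectedComponent (continuous_phiModuli _)
        (fun z _ => Quotient.inductionOn z fun ρ => phi_hol_rational hp hH ρ) hy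
        mem_connectedComponent
    rw [mem_centralLocus_iff] at hx ⊢
    rwa [this]
  · exact isPreconnected_connectedComponentIn.subset_connectedComponent
      (mem_connectedComponentIn hx)

/-! ### The strata -/

/-- The holonomies on the generators `a`, `c`, `d` of the flat connections in a stratum. -/
def holonomies (g : ℕ) {n : ℕ} (θ : Fin n → ℝ) : Set ((Fin n → SU2) × (Fin g → SU2 × SU2)) :=
  {v | (∀ j, phi (v.1 j) = θ j) ∧
    (List.ofFn v.1).prod = (List.ofFn fun i => comm (v.2 i).1 (v.2 i).2).prod}

/-- The holonomies on all generators, for `b = (-1) ^ l`. -/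
def genHolonomy (l : Fin 2) (v : (Fin n → SU2) × (Fin g → SU2 × SU2)) : Gen g n → SU2
  | .a j => v.1 j
  | .b => torusElement ((l.val : ℝ) / 2)
  | .c i => (v.2 i).1
  | .d i => (v.2 i).2

lemma genHolonomy_relators (hp : ∀ j, p j ≠ 0) {i : (Fin n → ℤ) × Fin 2}
    {v : (Fin n → SU2) × (Fin g → SU2 × SU2)} (hv : v ∈ holonomies g (phase p q i)) :
    ∀ r ∈ relators g p q, FreeGroup.lift (genHolonomy i.2 v) r = 1 := by
  rw [lift_relators_iff]
  refine ⟨fun j => ?_, fun y => ?_, hv.2⟩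
  · obtain ⟨k, hk⟩ := exists_diagonalization (v.1 j)
    simp only [genHolonomy]
    rw [conj_zpow_mul_torusElement_eq_one_iff i.2 _ _ hk, hv.1 j]
    refine ⟨i.1 j + q j * i.2.val, ?_⟩
    have : (p j : ℝ) ≠ 0 := by exact_mod_cast hp j
    unfold phase
    rw [mul_div_cancel₀ _ this]
    push_cast
    ring
  · refine commute_of_phi ?_ _
    rw [genHolonomy, (phi_eq_fin_two_half_iff i.2 _).2 rfl]
    exact fin_two_half i.2

lemma mk_mem_stratum (hp : ∀ j, p j ≠ 0) {i : (Fin n → ℤ) × Fin 2}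
    {v : (Fin n → SU2) × (Fin g → SU2 × SU2)} (hv : v ∈ holonomies g (phase p q i)) :
    (⟦mkHol _ (genHolonomy_relators hp hv)⟧ : Moduli g p q) ∈ stratum g p q i := by
  rw [mem_stratum_iff, phiModuli_mk, mkHol_gen]
  refine ⟨(phi_eq_fin_two_half_iff i.2 _).2 rfl, fun j => ?_⟩
  rw [phiModuli_mk, mkHol_gen]
  exact hv.1 j

lemma continuous_mkHol {X : Type*} [TopologicalSpace X] {f : X → Gen g n → SU2}
    (hf : ∀ y, Continuous fun x => f x y)
    (hr : ∀ x, ∀ r ∈ relators g p q, FreeGroup.lift (f x) r = 1) :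
    Continuous fun x => mkHol (f x) (hr x) := by
  refine continuous_induced_rng.2 (continuous_pi fun s => ?_)
  obtain ⟨w, rfl⟩ := PresentedGroup.mk_surjective _ s
  change Continuous fun x => FreeGroup.lift (f x) w
  induction w using FreeGroup.induction_on with
  | C1 => simpa using continuous_const
  | of y => simpa using hf y
  | inv_of y _ =>
    simp only [map_inv, FreeGroup.lift_apply_of]
    exact (hf y).inv
  | mul v w hv hw =>
    simp only [map_mul]
    exact hv.mul hw

lemma isPreconnected_stratum (hp : ∀ j, p j ≠ 0) (i : (Fin n → ℤ) × Fin 2) :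
    IsPreconnected (stratum g p q i) := by
  have hD : IsPreconnected (holonomies g (phase p q i)) := isPreconnected_holonomies g _
  have : PreconnectedSpace (holonomies g (phase p q i)) :=
    isPreconnected_iff_preconnectedSpace.1 hD
  let F : holonomies g (phase p q i) → Moduli g p q :=
    fun v => ⟦mkHol _ (genHolonomy_relators hp v.2)⟧
  have hF : Continuous F := by
    refine continuous_quotient_mk'.comp (continuous_mkHol (fun y => ?_) _)
    cases y <;> simp only [genHolonomy] <;> fun_prop
  have hrange : Set.range F = stratum g p q i := by
    ext x
    constructor
    · rintro ⟨v, rfl⟩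
      exact mk_mem_stratum hp v.2
    · induction x using Quotient.inductionOn with
      | h ρ =>
        intro hx
        rw [mem_stratum_iff] at hx
        refine ⟨⟨(fun j => ρ (gen g p q (.a j)),
          fun k => (ρ (gen g p q (.c k)), ρ (gen g p q (.d k)))), hx.2, (hol_relations ρ).2.2⟩, ?_⟩
        refine congrArg _ (hol_ext fun y => ?_)
        rw [mkHol_gen]
        cases y with
        | b => exact ((phi_eq_fin_two_half_iff i.2 _).1 hx.1).symm
        | _ => rfl
  rw [← hrange]
  exact isPreconnected_range hF

lemma stratum_eq_component (hp : ∀ j, p j ≠ 0) {i : (Fin n → ℤ) × Fin 2} {x : Moduli g p q}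
    (hx : x ∈ stratum g p q i) :
    stratum g p q i = connectedComponentIn (centralLocus g p q) x :=
  Set.Subset.antisymm ((isPreconnected_stratum hp i).subset_connectedComponentIn hx
    (stratum_subset_centralLocus i)) (component_subset_stratum hp hx)

/-! ### Irreducible and reducible connections -/

/-- In genus 1 a pair with nontrivial commutator cannot commute. In higher genus the first pair is
any non-commuting one and the second corrects the product. -/
lemma exists_prod_comm_eq {A : SU2} (h : g = 1 ∧ A ≠ 1 ∨ 2 ≤ g) :
    ∃ v : Fin g → SU2 × SU2, (List.ofFn fun i => comm (v i).1 (v i).2).prod = A ∧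
      ∃ i, (v i).1 * (v i).2 ≠ (v i).2 * (v i).1 := by
  rcases h with ⟨rfl, hA⟩ | hg
  · obtain ⟨c, d, hcd⟩ := exists_comm_eq A
    refine ⟨fun _ => (c, d), by simpa using hcd, 0, ?_⟩
    rwa [← hcd, Ne, comm_eq_one_iff] at hA
  · obtain ⟨k, rfl⟩ := Nat.exists_eq_add_of_le' hg
    obtain ⟨U, V, hUV⟩ := exists_not_commute
    obtain ⟨c, d, hcd⟩ := exists_comm_eq ((comm U V)⁻¹ * A)
    refine ⟨Fin.cons (U, V) (Fin.cons (c, d) fun _ => (1, 1)), ?_, 0, hUV⟩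
    have h1 : comm (1 : SU2) 1 = 1 := by simp [comm]
    simp [List.ofFn_succ, hcd, h1]

lemma exists_irreducible (hp : ∀ j, p j ≠ 0) {i : (Fin n → ℤ) × Fin 2}
    (hi : i ∈ indexSet g p q) : ∃ x ∈ irreducibleLocus g p q, x ∈ stratum g p q i := by
  obtain ⟨hθ, h0, h1⟩ := hi
  have hθ : ∀ j, phase p q i j ∈ Set.Icc (0 : ℝ) (1 / 2) := hθ
  obtain ⟨b1, b2, b3⟩ := dist_bounds hθ
  suffices h : ∃ v ∈ holonomies g (phase p q i), ∃ x y : Gen g n,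
      genHolonomy i.2 v x * genHolonomy i.2 v y ≠ genHolonomy i.2 v y * genHolonomy i.2 v x by
    obtain ⟨v, hv, x, y, hxy⟩ := h
    refine ⟨_, ⟨_, isIrreducible_of_not_commute (x := gen g p q x) (y := gen g p q y) ?_, rfl⟩,
      mk_mem_stratum hp hv⟩
    rwa [mkHol_gen, mkHol_gen]
  rcases Nat.eq_zero_or_pos g with rfl | hg
  · have hO := (quantumPolygon_iff hθ).1 (h0 rfl)
    have hE := oddDist_le hθ
    obtain ⟨a, ha, ha', j, k, hjk⟩ := exists_prod_phi_eq_not_commute hθ (y := 0)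
      ⟨le_rfl, by norm_num⟩ (by linarith) (by linarith)
    refine ⟨(a, Fin.elim0), ⟨ha, ?_⟩, .a j, .a k, hjk⟩
    simpa using (phi_eq_zero_iff _).1 ha'
  -- Taking the largest possible phase makes the product of the `a_j` differ from `1` whenever it
  -- can. It is forced to be `1` only if `evenDist` vanishes, the case excluded from the index set
  -- in genus 1.
  · obtain ⟨a, ha, ha'⟩ := exists_prod_phi_eq hθ (y := min (evenDist (phase p q i)) (1 / 2))
      ⟨le_min b1 (by norm_num), min_le_right _ _⟩ (le_min (by linarith) (by linarith))
      (min_le_left _ _)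
    obtain ⟨v, hv, k, hk⟩ := exists_prod_comm_eq (g := g) (A := (List.ofFn a).prod) (by
      rcases Nat.lt_or_ge g 2 with h2 | h2
      · have hg1 : g = 1 := by omega
        refine Or.inl ⟨hg1, fun h => ?_⟩
        rw [(phi_eq_zero_iff _).2 h] at ha'
        have hE : evenDist (phase p q i) = 0 := by
          rcases min_choice (evenDist (phase p q i)) (1 / 2) with h3 | h3 <;> rw [h3] at ha'
          · exact ha'.symm
          · norm_num at ha'
        exact h1 hg1 ((vertex_of_dist_eq_zero hθ).1 hE)
      · exact Or.inr h2)
    exact ⟨(a, v), ⟨ha, hv.symm⟩, .c k, .d k, hk⟩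

lemma mem_indexSet_of_irreducible {i : (Fin n → ℤ) × Fin 2} {x : Moduli g p q}
    (hx : x ∈ irreducibleLocus g p q) (hi : x ∈ stratum g p q i) : i ∈ indexSet g p q := by
  obtain ⟨ρ, hρ, rfl⟩ := hx
  obtain ⟨-, ha⟩ := (mem_stratum_iff _ _).1 hi
  simp only [phiModuli_mk] at ha
  have hθ (j : Fin n) : phase p q i j ∈ Set.Icc (0 : ℝ) (1 / 2) := ha j ▸ phi_mem _
  have hb := phi_b_of_isIrreducible hρ
  obtain ⟨-, -, hprod⟩ := hol_relations ρ
  refine ⟨hθ, ?_, ?_⟩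
  · rintro rfl
    rw [quantumPolygon_iff hθ]
    have hne : ∃ j k : Fin n, ρ (gen 0 p q (.a j)) * ρ (gen 0 p q (.a k)) ≠
        ρ (gen 0 p q (.a k)) * ρ (gen 0 p q (.a j)) := by
      obtain ⟨x, y, hxy⟩ := exists_gen_not_commute hρ
      cases x with
      | a j =>
        cases y with
        | a k => exact ⟨j, k, hxy⟩
        | b => exact absurd (commute_of_phi hb _).symm hxy
        | c k => exact k.elim0
        | d k => exact k.elim0
      | b => exact absurd (commute_of_phi hb _) hxy
      | c j => exact j.elim0
      | d j => exact j.elim0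
    have h := ((phi_prod_bounds fun j => ρ (gen 0 p q (.a j))).2 hne).1
    rw [hprod, List.ofFn_zero, List.prod_nil, (phi_eq_zero_iff _).2 rfl] at h
    simp only [ha] at h
    change 1 / 2 - oddDist (phase p q i) < 0 at h
    linarith
  · rintro rfl ⟨hv, k, hk⟩
    have hvc (j : Fin n) : phi (ρ (gen 1 p q (.a j))) = 0 ∨
        phi (ρ (gen 1 p q (.a j))) = 1 / 2 := ha j ▸ hv j
    have haT (j : Fin n) : ρ (gen 1 p q (.a j)) = torusElement (phase p q i j) := by
      have := hvc j
      rw [phi_eq_zero_iff, phi_eq_half_iff] at this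
      rcases this with h | h
      · rw [← ha j, (phi_eq_zero_iff _).2 h, h, torusElement_zero]
      · rw [← ha j, (phi_eq_half_iff _).2 h, h]
    simp only [haT] at hprod
    rw [prod_ofFn_torusElement, (torusElement_eq_one_iff _).2 ⟨k, hk⟩] at hprod
    have hcd : comm (ρ (gen 1 p q (.c 0))) (ρ (gen 1 p q (.d 0))) = 1 := by
      simpa using hprod.symm
    rw [comm_eq_one_iff] at hcd
    obtain ⟨x, y, hxy⟩ := exists_gen_not_commute hρ
    apply hxy
    cases x with
    | a j => exact commute_of_phi (hvc j) _
    | b => exact commute_of_phi hb _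
    | c j =>
      cases y with
      | a k => exact (commute_of_phi (hvc k) _).symm
      | b => exact (commute_of_phi hb _).symm
      | c k => rw [Subsingleton.elim j k]
      | d k => rw [Subsingleton.elim j 0, Subsingleton.elim k 0]; exact hcd
    | d j =>
      cases y with
      | a k => exact (commute_of_phi (hvc k) _).symm
      | b => exact (commute_of_phi hb _).symm
      | c k => rw [Subsingleton.elim j 0, Subsingleton.elim k 0]; exact hcd.symm
      | d k => rw [Subsingleton.elim j k]

lemma exists_reducible (hp : ∀ j, p j ≠ 0) {i : (Fin n → ℤ) × Fin 2}
    (hθ : ∀ j, 0 ≤ phase p q i j ∧ phase p q i j ≤ 1 / 2) {μ : Fin n → ℤ}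
    (hμ : ∀ j, μ j = 1 ∨ μ j = -1) {k : ℤ} (hk : ∑ j, (μ j : ℝ) * phase p q i j = k) :
    (stratum g p q i ∩ reducibleLocus g p q).Nonempty := by
  let v : (Fin n → SU2) × (Fin g → SU2 × SU2) :=
    -- Inversion preserves phases, so the signs are free; the integrality of the signed sum makes
    -- the product of these diagonal elements `1`.
    (fun j => torusElement (μ j * phase p q i j), fun _ => (1, 1))
  have hv : v ∈ holonomies g (phase p q i) := by
    refine ⟨fun j => ?_, ?_⟩
    · simp only [v]
      rcases hμ j with h | h <;> rw [h]
      · rw [Int.cast_one, one_mul, phi_torusElement (hθ j).1 (hθ j).2]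
      · rw [Int.cast_neg, Int.cast_one, neg_one_mul, ← torusElement_inv, phi_inv,
          phi_torusElement (hθ j).1 (hθ j).2]
    · simp only [v]
      rw [prod_ofFn_torusElement, (torusElement_eq_one_iff _).2 ⟨k, hk⟩]
      simp [comm]
  refine ⟨_, mk_mem_stratum hp hv, _, fun hirr => ?_, rfl⟩
  -- A diagonal element of phase `1/4` commutes with all holonomies without being central.
  have := (mem_center_iff _).1 (hirr (torusElement (1 / 4)) (commute_hol fun y => ?_))
  · rw [phi_torusElement (by norm_num) (by norm_num)] at this
    norm_num at this
  · rw [mkHol_gen]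
    cases y <;> simp only [genHolonomy, v]
    · exact torusElement_commute _ _
    · exact torusElement_commute _ _
    · simp
    · simp

lemma irreducibleLocus_subset_centralLocus :
    irreducibleLocus g p q ⊆ centralLocus g p q := by
  rintro _ ⟨ρ, hρ, rfl⟩
  exact (mem_centralLocus_iff _).2 (phi_b_of_isIrreducible hρ)

lemma bijOn_stratum (hp : ∀ j, p j ≠ 0) :
    Set.BijOn (stratum g p q) (indexSet g p q)
      {C | ∃ x ∈ irreducibleLocus g p q, C = connectedComponentIn (centralLocus g p q) x} := by
  refine ⟨fun i hi => ?_, fun i hi i' _ heq => ?_, ?_⟩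
  · obtain ⟨x, hx, hxi⟩ := exists_irreducible hp hi
    exact ⟨x, hx, stratum_eq_component hp hxi⟩
  · obtain ⟨x, -, hxi⟩ := exists_irreducible hp hi
    exact stratum_injective hp hxi (heq ▸ hxi)
  · rintro _ ⟨x, hx, rfl⟩
    obtain ⟨i, hi⟩ := exists_mem_stratum hp (irreducibleLocus_subset_centralLocus hx)
    exact ⟨i, mem_indexSet_of_irreducible hx hi, stratum_eq_component hp hi⟩

end SeifertFlat

end

theorem proposition2p2p2 (g n : ℕ) (p q : Fin n → ℤ) (hp : ∀ j, p j ≠ 0)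
    (hpq : ∀ j, IsCoprime (p j) (q j)) :
    -- components of the space of flat connections with `φ(b) = 0, 1/2`
    Set.BijOn (SeifertFlat.stratum g p q) (SeifertFlat.indexSet g p q)
      {C | ∃ x ∈ SeifertFlat.irreducibleLocus g p q,
        C = connectedComponentIn (SeifertFlat.centralLocus g p q) x} ∧
    -- components of the whole moduli space
    (SeifertFlat.eulerH p q ≠ 0 →
      Set.BijOn (SeifertFlat.stratum g p q) (SeifertFlat.indexSet g p q)
        {C | ∃ x ∈ SeifertFlat.irreducibleLocus g p q, C = connectedComponent x}) ∧
    -- special components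
    ∀ i ∈ SeifertFlat.indexSet g p q,
      (∃ μ : Fin n → ℤ, (∀ j, μ j = 1 ∨ μ j = -1) ∧
        ∃ k : ℤ, ∑ j, (μ j : ℝ) * SeifertFlat.phase p q i j = k) →
      (SeifertFlat.stratum g p q i ∩ SeifertFlat.reducibleLocus g p q).Nonempty := by
  refine ⟨SeifertFlat.bijOn_stratum hp, fun hH => ?_, ?_⟩
  · convert SeifertFlat.bijOn_stratum (g := g) (q := q) hp using 1
    ext C
    refine exists_congr fun x => and_congr_right fun hx => ?_
    rw [SeifertFlat.connectedComponent_eq hp hH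
      (SeifertFlat.irreducibleLocus_subset_centralLocus hx)]
  · rintro i hi ⟨μ, hμ, k, hk⟩
    exact SeifertFlat.exists_reducible hp hi.1 hμ hk
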